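/- Let $k$ be a commutative ring with unit. Let $\Gamma$ be the $k$-algebra of $\mathbb{N}\times\mathbb{N}$-matrices $A$ over $k$ such that the set of entries $\{A_{i,j}\}$ is finite and there is a natural number $n_A$ such that each row and each column of $A$ has at most $n_A$ non-zero entries (with entrywise $k$-module structure and ordinary matrix multiplication). Let $\theta=(\theta_1,\theta_2):\mathbb{N}\to\mathbb{N}\times\mathbb{N}$ be a bijection and let $\phi:\Gamma\to\Gamma$ be the $k$-algebra homomorphism with $\phi(A)_{i,j}=A_{\theta_1(i),\theta_1(j)}$ if $\theta_2(i)=\theta_2(j)$ and $\phi(A)_{i,j}=0$ otherwise. Let $W$ be the $\Gamma$-$\Gamma$-bimodule which is $\Gamma$ as a left module and on which $A\in\Gamma$ acts on the right by $B\mapsto B\cdot\phi(A)$. Let $\mathcal{C}_{\mathrm{dg}}(\Gamma)$ be the dg category (over $k$) of unbounded complexes of right $\Gamma$-modules, and let $\mathrm{perf}_{\mathrm{dg}}(\Gamma)$, resp. $\mathrm{perf}(\Gamma)$, be its full dg subcategory, resp. the full subcategory of the ordinary category of complexes, whose objects are the complexes which are cofibrant for the projective model structure and compact in the derived category $\mathcal{D}(\Gamma)$.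 Then the dg category $\mathrm{perf}_{\mathrm{dg}}(\Gamma)$ is flasque. That is: 1. the category $Z^0(\mathrm{perf}_{\mathrm{dg}}(\Gamma))$ is equivalent to $\mathrm{perf}(\Gamma)$; 2. $\mathrm{perf}_{\mathrm{dg}}(\Gamma)$ has sums: the diagonal dg functor $\mathrm{perf}_{\mathrm{dg}}(\Gamma)\to\mathrm{perf}_{\mathrm{dg}}(\Gamma)\times\mathrm{perf}_{\mathrm{dg}}(\Gamma)$ has a left adjoint dg functor $\oplus$; 3. there are a dg functor $\tau:\mathrm{perf}_{\mathrm{dg}}(\Gamma)\to\mathrm{perf}_{\mathrm{dg}}(\Gamma)$ and a natural isomorphism of dg functors $\mathrm{Id}\oplus\tau\simeq\tau$. Moreover, $\tau$ can be chosen to be, up to natural isomorphism of dg functors, the restriction to $\mathrm{perf}_{\mathrm{dg}}(\Gamma)$ of the dg endofunctor $W\otimes_\Gamma-$, where right $\Gamma$-modules are identified with left $\Gamma$-modules by means of the transposition isomorphism $\Gamma^{\mathrm{op}}\simeq\Gamma$. -/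

import Mathlib

universe v v₁ v₂ v₃ u w w₁ w₂ w₃

open CategoryTheory

/-! ## The algebra of infinite matrices -/

/-- An `ℕ × ℕ`-matrix has finitely many distinct entries, and the number of non-zero entries
in each row and in each column is bounded by one and the same natural number. -/
def IsConeMatrix {k : Type u} [CommRing k] (A : ℕ → ℕ → k) : Prop :=
  (Set.range fun p : ℕ × ℕ => A p.1 p.2).Finite ∧
    ∃ n : ℕ, (∀ i, {j | A i j ≠ 0}.encard ≤ n) ∧ ∀ j, {i | A i j ≠ 0}.encard ≤ n

theorem IsConeMatrix.add {k : Type u} [CommRing k] {A B : ℕ → ℕ → k}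
    (hA : IsConeMatrix A) (hB : IsConeMatrix B) : IsConeMatrix (A + B) := by
  obtain ⟨hA, n, hA1, hA2⟩ := hA
  obtain ⟨hB, m, hB1, hB2⟩ := hB
  refine ⟨(hA.add hB).subset ?_, n + m, fun i => ?_, fun j => ?_⟩
  · rintro _ ⟨p, rfl⟩
    exact Set.add_mem_add ⟨p, rfl⟩ ⟨p, rfl⟩
  · refine le_trans (Set.encard_le_encard (t := {j | A i j ≠ 0} ∪ {j | B i j ≠ 0}) ?_)
      ((Set.encard_union_le _ _).trans (by push_cast; exact add_le_add (hA1 i) (hB1 i)))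
    intro j hj
    by_contra h
    simp only [Set.mem_union, Set.mem_ofPred_eq, not_or, not_not] at h
    exact hj (by simp [h.1, h.2])
  · refine le_trans (Set.encard_le_encard (t := {i | A i j ≠ 0} ∪ {i | B i j ≠ 0}) ?_)
      ((Set.encard_union_le _ _).trans (by push_cast; exact add_le_add (hA2 j) (hB2 j)))
    intro i hi
    by_contra h
    simp only [Set.mem_union, Set.mem_ofPred_eq, not_or, not_not] at h
    exact hi (by simp [h.1, h.2])

theorem IsConeMatrix.zero {k : Type u} [CommRing k] : IsConeMatrix (0 : ℕ → ℕ → k) :=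
  ⟨(Set.finite_singleton (0 : k)).subset (by rintro _ ⟨p, rfl⟩; simp), 0, by simp, by simp⟩

theorem IsConeMatrix.smul {k : Type u} [CommRing k] {A : ℕ → ℕ → k}
    (c : k) (hA : IsConeMatrix A) : IsConeMatrix (c • A) := by
  obtain ⟨hA, n, hA1, hA2⟩ := hA
  refine ⟨(hA.image (c * ·)).subset ?_, n,
    fun i => (Set.encard_le_encard ?_).trans (hA1 i),
    fun j => (Set.encard_le_encard ?_).trans (hA2 j)⟩
  · rintro _ ⟨p, rfl⟩
    exact ⟨_, ⟨p, rfl⟩, by simp⟩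
  · intro j hj h
    exact hj (by simp [h])
  · intro i hi h
    exact hi (by simp [h])

theorem IsConeMatrix.transpose {k : Type u} [CommRing k] {A : ℕ → ℕ → k}
    (hA : IsConeMatrix A) : IsConeMatrix (fun i j => A j i) := by
  obtain ⟨hA, n, hA1, hA2⟩ := hA
  refine ⟨hA.subset ?_, n, hA2, hA1⟩
  rintro _ ⟨p, rfl⟩
  exact ⟨(p.2, p.1), rfl⟩

/-- The `k`-module of cone matrices, with entrywise structure. -/
def coneSubmodule (k : Type u) [CommRing k] : Submodule k (ℕ → ℕ → k) where
  carrier := {A | IsConeMatrix A}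
  add_mem' := IsConeMatrix.add
  zero_mem' := IsConeMatrix.zero
  smul_mem' := fun c _ h => h.smul c

/-- The `k`-algebra `Γ` of cone matrices. -/
def Cone (k : Type u) [CommRing k] : Type u := coneSubmodule k

namespace Cone

variable {k : Type u} [CommRing k]

instance : AddCommGroup (Cone k) := inferInstanceAs (AddCommGroup (coneSubmodule k))

instance : Module k (Cone k) := inferInstanceAs (Module k (coneSubmodule k))

/-- The entry of a cone matrix in row `i` and column `j`. -/
def entry (A : Cone k) (i j : ℕ) : k := A.1 i j

theorem isConeMatrix (A : Cone k) : IsConeMatrix A.entry := A.2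

/-- Build a cone matrix from its entries. -/
def mk (A : ℕ → ℕ → k) (h : IsConeMatrix A) : Cone k := ⟨A, h⟩

@[simp] theorem entry_mk (A : ℕ → ℕ → k) (h : IsConeMatrix A) (i j : ℕ) :
    (mk A h).entry i j = A i j := rfl

@[ext] theorem ext {A B : Cone k} (h : ∀ i j, A.entry i j = B.entry i j) : A = B :=
  Subtype.ext (funext fun i => funext fun j => h i j)

@[simp] theorem entry_add (A B : Cone k) (i j : ℕ) :
    (A + B).entry i j = A.entry i j + B.entry i j := rfl

@[simp] theorem entry_zero (i j : ℕ) : (0 : Cone k).entry i j = 0 := rfl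

@[simp] theorem entry_smul (c : k) (A : Cone k) (i j : ℕ) :
    (c • A).entry i j = c * A.entry i j := rfl

theorem row_finite (A : Cone k) (i : ℕ) : {j | A.entry i j ≠ 0}.Finite := by
  obtain ⟨-, n, h, -⟩ := A.isConeMatrix
  exact Set.finite_of_encard_le_coe (h i)

theorem col_finite (A : Cone k) (j : ℕ) : {i | A.entry i j ≠ 0}.Finite := by
  obtain ⟨-, n, -, h⟩ := A.isConeMatrix
  exact Set.finite_of_encard_le_coe (h j)

/-- The entries of the matrix product (all the sums are finite). -/
noncomputable def mulEntry (A B : Cone k) (i j : ℕ) : k := ∑ᶠ l, A.entry i l * B.entry l j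

theorem mulEntry_row (A B : Cone k) (i j : ℕ) (s : Finset ℕ)
    (hs : ∀ l, A.entry i l ≠ 0 → l ∈ s) :
    mulEntry A B i j = ∑ l ∈ s, A.entry i l * B.entry l j := by
  refine finsum_eq_sum_of_support_subset _ fun l hl => hs l ?_
  intro h
  exact hl (by simp [h])

theorem mulEntry_col (A B : Cone k) (i j : ℕ) (s : Finset ℕ)
    (hs : ∀ l, B.entry l j ≠ 0 → l ∈ s) :
    mulEntry A B i j = ∑ l ∈ s, A.entry i l * B.entry l j := by
  refine finsum_eq_sum_of_support_subset _ fun l hl => hs l ?_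
  intro h
  exact hl (by simp [h])

theorem finite_boundedSums (F : Set k) (hF : F.Finite) (n : ℕ) :
    {x : k | ∃ (s : Finset ℕ) (f : ℕ → k), s.card ≤ n ∧ (∀ l ∈ s, f l ∈ F) ∧
      x = ∑ l ∈ s, f l}.Finite := by
  induction n with
  | zero =>
    refine (Set.finite_singleton (0 : k)).subset ?_
    rintro x ⟨s, f, hs, -, rfl⟩
    simp [Finset.card_eq_zero.mp (Nat.le_zero.mp hs)]
  | succ n ih =>
    refine ((Set.finite_singleton (0 : k)).union (hF.add ih)).subset ?_
    rintro x ⟨s, f, hs, hf, rfl⟩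
    rcases s.eq_empty_or_nonempty with rfl | ⟨a, ha⟩
    · left; simp
    · right
      rw [← Finset.add_sum_erase s f ha]
      refine Set.add_mem_add (hf a ha) ⟨s.erase a, f, ?_, ?_, rfl⟩
      · rw [Finset.card_erase_of_mem ha]; omega
      · exact fun l hl => hf l (Finset.mem_of_mem_erase hl)

theorem encard_biUnion_le (s : Finset ℕ) (t : ℕ → Set ℕ) (m : ℕ)
    (h : ∀ l ∈ s, (t l).encard ≤ m) : (⋃ l ∈ s, t l).encard ≤ (s.card * m : ℕ) := by
  induction s using Finset.induction_on with
  | empty => simp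
  | insert a s ha ih =>
    rw [Finset.set_biUnion_insert, Finset.card_insert_of_notMem ha]
    refine (Set.encard_union_le _ _).trans ?_
    have h1 := h a (Finset.mem_insert_self a s)
    have h2 := ih fun l hl => h l (Finset.mem_insert_of_mem hl)
    calc _ ≤ (m : ℕ∞) + ((s.card * m : ℕ) : ℕ∞) := add_le_add h1 h2
      _ = (((s.card + 1) * m : ℕ) : ℕ∞) := by push_cast; ring

theorem isConeMatrix_mulEntry (A B : Cone k) : IsConeMatrix (mulEntry A B) := by
  obtain ⟨hA, n, hA1, hA2⟩ := A.isConeMatrix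
  obtain ⟨hB, m, hB1, hB2⟩ := B.isConeMatrix
  have cardle : ∀ {S : Set ℕ} (hS : S.Finite) {r : ℕ}, S.encard ≤ r → hS.toFinset.card ≤ r := by
    intro S hS r h
    rw [hS.encard_eq_coe_toFinset_card] at h
    exact_mod_cast h
  refine ⟨(finite_boundedSums _ (hA.mul hB) n).subset ?_, n * m, fun i => ?_, fun j => ?_⟩
  · rintro _ ⟨⟨i, j⟩, rfl⟩
    refine ⟨(A.row_finite i).toFinset, fun l => A.entry i l * B.entry l j,
      cardle _ (hA1 i), fun l _ => Set.mul_mem_mul ⟨(i, l), rfl⟩ ⟨(l, j), rfl⟩, ?_⟩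
    exact mulEntry_row A B i j _ fun l hl => by simpa using hl
  · have := encard_biUnion_le (A.row_finite i).toFinset (fun l => {j | B.entry l j ≠ 0}) m
      fun l _ => hB1 l
    refine (Set.encard_le_encard ?_).trans (this.trans ?_)
    · intro j hj
      rw [Set.mem_ofPred_eq, mulEntry_row A B i j (A.row_finite i).toFinset
        fun l hl => by simpa using hl] at hj
      obtain ⟨l, hl, hne⟩ := Finset.exists_ne_zero_of_sum_ne_zero hj
      exact Set.mem_biUnion hl fun h => hne (by simp [h])
    · exact_mod_cast Nat.mul_le_mul_right m (cardle (A.row_finite i) (hA1 i))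
  · have := encard_biUnion_le (B.col_finite j).toFinset (fun l => {i | A.entry i l ≠ 0}) n
      fun l _ => hA2 l
    refine (Set.encard_le_encard ?_).trans (this.trans ?_)
    · intro i hi
      rw [Set.mem_ofPred_eq, mulEntry_col A B i j (B.col_finite j).toFinset
        fun l hl => by simpa using hl] at hi
      obtain ⟨l, hl, hne⟩ := Finset.exists_ne_zero_of_sum_ne_zero hi
      exact Set.mem_biUnion hl fun h => hne (by simp [h])
    · rw [mul_comm n m]
      exact_mod_cast Nat.mul_le_mul_right n (cardle (B.col_finite j) (hB2 j))

theorem isConeMatrix_one : IsConeMatrix (fun i j => if i = j then (1 : k) else 0) := by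
  refine ⟨((Set.finite_singleton (1 : k)).union (Set.finite_singleton 0)).subset ?_, 1,
    fun i => ?_, fun j => ?_⟩
  · rintro _ ⟨p, rfl⟩
    by_cases h : p.1 = p.2 <;> simp [h]
  · refine (Set.encard_le_encard (t := {i}) ?_).trans (by simp)
    intro j hj
    by_contra h
    exact hj (if_neg fun e => h e.symm)
  · refine (Set.encard_le_encard (t := {j}) ?_).trans (by simp)
    intro i hi
    by_contra h
    exact hi (if_neg fun e => h e)

/-- Ordinary matrix multiplication. -/
noncomputable instance : Mul (Cone k) := ⟨fun A B => mk _ (isConeMatrix_mulEntry A B)⟩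

/-- The identity matrix. -/
instance : One (Cone k) := ⟨mk _ isConeMatrix_one⟩

theorem entry_mul (A B : Cone k) (i j : ℕ) :
    (A * B).entry i j = ∑ᶠ l, A.entry i l * B.entry l j := rfl

theorem entry_one (i j : ℕ) : (1 : Cone k).entry i j = if i = j then 1 else 0 := rfl

theorem entry_mul_row (A B : Cone k) (i j : ℕ) (s : Finset ℕ)
    (hs : ∀ l, A.entry i l ≠ 0 → l ∈ s) :
    (A * B).entry i j = ∑ l ∈ s, A.entry i l * B.entry l j := mulEntry_row A B i j s hs

theorem entry_mul_col (A B : Cone k) (i j : ℕ) (s : Finset ℕ)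
    (hs : ∀ l, B.entry l j ≠ 0 → l ∈ s) :
    (A * B).entry i j = ∑ l ∈ s, A.entry i l * B.entry l j := mulEntry_col A B i j s hs

theorem entry_mul_row' (A B : Cone k) (i j : ℕ) :
    (A * B).entry i j = ∑ l ∈ (A.row_finite i).toFinset, A.entry i l * B.entry l j :=
  entry_mul_row A B i j _ fun l hl => by simpa using hl

theorem entry_mul_col' (A B : Cone k) (i j : ℕ) :
    (A * B).entry i j = ∑ l ∈ (B.col_finite j).toFinset, A.entry i l * B.entry l j :=
  entry_mul_col A B i j _ fun l hl => by simpa using hl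

noncomputable instance : Ring (Cone k) :=
  { (inferInstance : AddCommGroup (Cone k)),
    (inferInstance : Mul (Cone k)),
    (inferInstance : One (Cone k)) with
    left_distrib := fun A B C => by
      ext i j
      simp only [entry_mul_row' A, entry_add, mul_add, Finset.sum_add_distrib]
    right_distrib := fun A B C => by
      ext i j
      simp only [entry_mul_col' _ C, entry_add, add_mul, Finset.sum_add_distrib]
    zero_mul := fun A => by
      ext i j
      simp [entry_mul]
    mul_zero := fun A => by
      ext i j
      simp [entry_mul]
    mul_assoc := fun A B C => by
      ext i j
      rw [entry_mul_col' _ C, entry_mul_row' A]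
      simp only [entry_mul_row' A B, entry_mul_col' B C, Finset.sum_mul, Finset.mul_sum]
      rw [Finset.sum_comm]
      simp only [mul_assoc]
    one_mul := fun A => by
      ext i j
      rw [entry_mul_row _ _ i j {i} (by
        intro l hl
        by_contra h
        exact hl (if_neg fun e => h (by simp [e])))]
      simp [entry_one]
    mul_one := fun A => by
      ext i j
      rw [entry_mul_col _ _ i j {j} (by
        intro l hl
        by_contra h
        exact hl (if_neg fun e => h (by simp [e])))]
      simp [entry_one] }

noncomputable instance : Algebra k (Cone k) :=
  Algebra.ofModule
    (fun c A B => by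
      ext i j
      simp only [entry_smul, entry_mul_col' _ B, Finset.mul_sum, mul_assoc])
    (fun c A B => by
      ext i j
      simp only [entry_smul, entry_mul_row' A, Finset.mul_sum]
      exact Finset.sum_congr rfl fun l _ => by ring)

/-- Transposition, as a ring isomorphism from `Γ` to its opposite. -/
noncomputable def transposeEquiv (k : Type u) [CommRing k] : Cone k ≃+* (Cone k)ᵐᵒᵖ where
  toFun A := MulOpposite.op (mk _ A.isConeMatrix.transpose)
  invFun A := mk _ A.unop.isConeMatrix.transpose
  left_inv _ := rfl
  right_inv _ := rfl
  map_add' _ _ := rfl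
  map_mul' A B := by
    apply MulOpposite.unop_injective
    ext i j
    change (A * B).entry j i = (mk _ B.isConeMatrix.transpose * mk _ A.isConeMatrix.transpose :
      Cone k).entry i j
    simp only [entry_mul, entry_mk, mul_comm]

variable (θ : ℕ ≃ ℕ × ℕ)

/-- The matrix `φ(A)`, with entry `A_{θ₁(i), θ₁(j)}` at `(i, j)` if `θ₂(i) = θ₂(j)`, and `0`
otherwise. -/
def phiEntry (A : Cone k) (i j : ℕ) : k :=
  if (θ i).2 = (θ j).2 then A.entry (θ i).1 (θ j).1 else 0

theorem isConeMatrix_phiEntry (A : Cone k) : IsConeMatrix (phiEntry θ A) := by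
  obtain ⟨hA, n, hA1, hA2⟩ := A.isConeMatrix
  refine ⟨((Set.finite_singleton (0 : k)).union hA).subset ?_, n, fun i => ?_, fun j => ?_⟩
  · rintro _ ⟨⟨i, j⟩, rfl⟩
    by_cases h : (θ i).2 = (θ j).2
    · right
      exact ⟨((θ i).1, (θ j).1), by simp [phiEntry, h]⟩
    · left
      simp [phiEntry, h]
  · refine le_trans (Set.encard_le_encard_of_injOn (f := fun j => (θ j).1)
      (t := {j | A.entry (θ i).1 j ≠ 0}) ?_ ?_) (hA1 (θ i).1)
    · intro j hj h
      have h' : A.entry (θ i).1 (θ j).1 = 0 := h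
      exact hj (by simp [phiEntry, h'])
    · intro j hj j' hj' h
      have e : (θ i).2 = (θ j).2 := by
        by_contra e; exact hj (if_neg e)
      have e' : (θ i).2 = (θ j').2 := by
        by_contra e; exact hj' (if_neg e)
      exact θ.injective (Prod.ext h (e.symm.trans e'))
  · refine le_trans (Set.encard_le_encard_of_injOn (f := fun i => (θ i).1)
      (t := {i | A.entry i (θ j).1 ≠ 0}) ?_ ?_) (hA2 (θ j).1)
    · intro i hi h
      have h' : A.entry (θ i).1 (θ j).1 = 0 := h
      exact hi (by simp [phiEntry, h'])
    · intro i hi i' hi' h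
      have e : (θ i).2 = (θ j).2 := by
        by_contra e; exact hi (if_neg e)
      have e' : (θ i').2 = (θ j).2 := by
        by_contra e; exact hi' (if_neg e)
      exact θ.injective (Prod.ext h (e.trans e'.symm))

/-- The `k`-algebra endomorphism `φ` of `Γ`. -/
noncomputable def phi : Cone k →ₐ[k] Cone k :=
  AlgHom.ofLinearMap
    { toFun := fun A => mk _ (isConeMatrix_phiEntry θ A)
      map_add' := fun A B => by
        ext i j
        by_cases h : (θ i).2 = (θ j).2 <;> simp [phiEntry, h]
      map_smul' := fun c A => by
        ext i j
        by_cases h : (θ i).2 = (θ j).2 <;> simp [phiEntry, h] }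
    (by
      ext i j
      change (if (θ i).2 = (θ j).2 then (if (θ i).1 = (θ j).1 then (1 : k) else 0) else 0) =
        if i = j then 1 else 0
      by_cases h : i = j
      · simp [h]
      · by_cases h2 : (θ i).2 = (θ j).2
        · have h1 : (θ i).1 ≠ (θ j).1 := fun h1 => h (θ.injective (Prod.ext h1 h2))
          simp [h, h1]
        · simp [h, h2])
    (fun A B => by
      ext i j
      change (if (θ i).2 = (θ j).2 then (A * B).entry (θ i).1 (θ j).1 else 0) =
        ∑ᶠ l, phiEntry θ A i l * phiEntry θ B l j
      have key : ∀ l, (θ l).2 ≠ (θ i).2 → phiEntry θ A i l * phiEntry θ B l j = 0 := by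
        intro l hl
        rw [phiEntry, if_neg (Ne.symm hl), zero_mul]
      rw [← finsum_comp_equiv θ.symm]
      rw [entry_mul_row' A]
      rw [finsum_eq_sum_of_support_subset (s := (A.row_finite (θ i).1).toFinset.map
        ⟨fun l => (l, (θ i).2), fun a b h => congrArg Prod.fst h⟩)]
      · rw [Finset.sum_map]
        by_cases h : (θ i).2 = (θ j).2
        · rw [if_pos h]
          refine Finset.sum_congr rfl fun l _ => ?_
          simp [phiEntry, h]
        · rw [if_neg h]
          refine (Finset.sum_eq_zero fun l _ => ?_).symm
          have e : phiEntry θ B (θ.symm (l, (θ i).2)) j = 0 := by simp [phiEntry, h]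
          exact mul_eq_zero_of_right _ e
      · rintro ⟨l, m⟩ hl
        have hm : m = (θ i).2 := by
          by_contra hm
          exact hl (key _ (by simpa using hm))
        subst hm
        simp only [Finset.coe_map, Set.mem_image, Finset.mem_coe,
          Set.Finite.mem_toFinset, Set.mem_ofPred_eq]
        refine ⟨l, fun h => hl ?_, rfl⟩
        simp [phiEntry, h])

theorem entry_phi (A : Cone k) (i j : ℕ) :
    (phi θ A).entry i j = if (θ i).2 = (θ j).2 then A.entry (θ i).1 (θ j).1 else 0 := rfl

end Cone

/-! ## The twisted bimodule and tensor products over a noncommutative ring -/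

/-- The `Γ`-`Γ`-bimodule `W`: it is `Γ` as a left module, and `A` acts on the right by
`B ↦ B * φ(A)`. -/
def TwistedBimodule (k : Type u) [CommRing k] (_θ : ℕ ≃ ℕ × ℕ) : Type u := Cone k

namespace TwistedBimodule

variable {k : Type u} [CommRing k] (θ : ℕ ≃ ℕ × ℕ)

noncomputable instance : AddCommGroup (TwistedBimodule k θ) :=
  inferInstanceAs (AddCommGroup (Cone k))

noncomputable instance : Module (Cone k) (TwistedBimodule k θ) :=
  inferInstanceAs (Module (Cone k) (Cone k))

noncomputable instance : Module (Cone k)ᵐᵒᵖ (TwistedBimodule k θ) :=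
  Module.compHom (Cone k) (Cone.phi (k := k) θ).toRingHom.op

instance : SMulCommClass (Cone k) (Cone k)ᵐᵒᵖ (TwistedBimodule k θ) where
  smul_comm A B X := (mul_assoc (A : Cone k) X (Cone.phi θ B.unop)).symm

theorem smul_def (A : Cone k) (B : TwistedBimodule k θ) :
    A • B = (A * (show Cone k from B) : Cone k) := rfl

theorem op_smul_def (A : Cone k) (B : TwistedBimodule k θ) :
    MulOpposite.op A • B = ((show Cone k from B) * Cone.phi θ A : Cone k) := rfl

end TwistedBimodule

section Tensor

open TensorProduct

variable (R : Type u) [Ring R] (X : Type u) [AddCommGroup X] [Module R X] [Module Rᵐᵒᵖ X]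

/-- The submodule of `X ⊗_ℤ P` generated by all `xa ⊗ p - x ⊗ ap`. -/
def tensorRelations (P : Type u) [AddCommGroup P] [Module R P] : Submodule R (X ⊗[ℤ] P) :=
  Submodule.span R {t | ∃ (x : X) (a : R) (p : P),
    t = (MulOpposite.op a • x) ⊗ₜ[ℤ] p - x ⊗ₜ[ℤ] (a • p)}

/-- The map `X ⊗_R P → X ⊗_R Q` induced by `f : P → Q`. -/
noncomputable def bimoduleTensorMap {P Q : Type u} [AddCommGroup P] [Module R P]
    [AddCommGroup Q] [Module R Q] (f : P →ₗ[R] Q) :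
    ((X ⊗[ℤ] P) ⧸ tensorRelations R X P) →ₗ[R] ((X ⊗[ℤ] Q) ⧸ tensorRelations R X Q) :=
  Submodule.mapQ _ _ (TensorProduct.AlgebraTensorModule.map (LinearMap.id : X →ₗ[R] X)
    (f.toAddMonoidHom.toIntLinearMap)) (by
      rw [tensorRelations, Submodule.span_le]
      rintro _ ⟨x, a, p, rfl⟩
      exact Submodule.subset_span ⟨x, a, f p, by simp⟩)

theorem bimoduleTensor_ext {P Q : Type u} [AddCommGroup P] [Module R P]
    [AddCommGroup Q] [Module R Q] {f g : ((X ⊗[ℤ] P) ⧸ tensorRelations R X P) →ₗ[R] Q}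
    (h : ∀ x p, f (Submodule.Quotient.mk (x ⊗ₜ p)) = g (Submodule.Quotient.mk (x ⊗ₜ p))) :
    f = g := by
  refine LinearMap.ext fun t => ?_
  obtain ⟨t, rfl⟩ := Submodule.Quotient.mk_surjective _ t
  induction t using TensorProduct.induction_on with
  | zero => rw [Submodule.Quotient.mk_zero, map_zero, map_zero]
  | tmul x p => exact h x p
  | add x y hx hy => rw [Submodule.Quotient.mk_add, map_add, map_add, hx, hy]

@[simp] theorem bimoduleTensorMap_mk {P Q : Type u} [AddCommGroup P] [Module R P]
    [AddCommGroup Q] [Module R Q] (f : P →ₗ[R] Q) (x : X) (p : P) :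
    bimoduleTensorMap R X f (Submodule.Quotient.mk (x ⊗ₜ[ℤ] p)) =
      Submodule.Quotient.mk (x ⊗ₜ[ℤ] f p) := rfl

/-- The functor `X ⊗_R -` from left `R`-modules to left `R`-modules, for an
`R`-`R`-bimodule `X`: the object `X ⊗_R P` is the quotient of `X ⊗_ℤ P` by the relations
`xa ⊗ p = x ⊗ ap`. -/
noncomputable def bimoduleTensor [SMulCommClass R Rᵐᵒᵖ X] : ModuleCat.{u} R ⥤ ModuleCat.{u} R where
  obj P := ModuleCat.of R ((X ⊗[ℤ] P) ⧸ tensorRelations R X P)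
  map f := ModuleCat.ofHom (bimoduleTensorMap R X f.hom)
  map_id _ := ModuleCat.hom_ext (bimoduleTensor_ext R X fun _ _ => rfl)
  map_comp _ _ := ModuleCat.hom_ext (bimoduleTensor_ext R X fun _ _ => rfl)

instance [SMulCommClass R Rᵐᵒᵖ X] : (bimoduleTensor R X).Additive where
  map_add {_ _ f g} := ModuleCat.hom_ext (bimoduleTensor_ext R X fun x p =>
    congrArg Submodule.Quotient.mk (TensorProduct.tmul_add x (f.hom p) (g.hom p)))

end Tensor

section Twist

open scoped ModuleCat.Algebra

variable (k : Type u) [CommRing k] (θ : ℕ ≃ ℕ × ℕ)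

theorem Cone.transposeEquiv_algebraMap (c : k) :
    Cone.transposeEquiv k (algebraMap k (Cone k) c) = algebraMap k (Cone k)ᵐᵒᵖ c := by
  apply MulOpposite.unop_injective
  rw [MulOpposite.algebraMap_apply, MulOpposite.unop_op, Algebra.algebraMap_eq_smul_one]
  ext i j
  change c * (if j = i then (1 : k) else 0) = c * (if i = j then (1 : k) else 0)
  simp only [eq_comm]

instance : (bimoduleTensor (Cone k) (TwistedBimodule k θ)).Linear k where
  map_smul {_ Q} f c := ModuleCat.hom_ext (bimoduleTensor_ext _ _ fun x p => by
    change Submodule.Quotient.mk (x ⊗ₜ[ℤ] (algebraMap k (Cone k) c • f.hom p)) =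
      algebraMap k (Cone k) c • (Submodule.Quotient.mk (x ⊗ₜ[ℤ] f.hom p) :
        (TensorProduct ℤ (TwistedBimodule k θ) Q) ⧸
          tensorRelations (Cone k) (TwistedBimodule k θ) Q)
    rw [← Submodule.Quotient.mk_smul, TensorProduct.smul_tmul']
    have e : algebraMap k (Cone k) c • x =
        MulOpposite.op (algebraMap k (Cone k) c) • x := by
      rw [TwistedBimodule.op_smul_def, AlgHom.commutes]
      exact Algebra.commutes c (show Cone k from x)
    rw [e]
    refine ((Submodule.Quotient.eq _).mpr (Submodule.subset_span ?_)).symm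
    exact ⟨x, _, _, rfl⟩)

/-- The functor `W ⊗_Γ -`, transported from left to right `Γ`-modules along the transposition
`Γᵒᵖ ≃ Γ`: a right module `P` is made into a left module by `A · p = p · Aᵀ`, then tensored
with `W`, and the result is made into a right module by `q · A = Aᵀ · q`. -/
noncomputable def twist : ModuleCat.{u} (Cone k)ᵐᵒᵖ ⥤ ModuleCat.{u} (Cone k)ᵐᵒᵖ :=
  ModuleCat.restrictScalars (Cone.transposeEquiv k).toRingHom ⋙
    bimoduleTensor (Cone k) (TwistedBimodule k θ) ⋙
      ModuleCat.restrictScalars (Cone.transposeEquiv k).symm.toRingHom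

instance : (twist k θ).Additive := by
  unfold twist; infer_instance

instance : (ModuleCat.restrictScalars.{u} (Cone.transposeEquiv k).toRingHom).Linear k where
  map_smul f c := by
    ext p
    change algebraMap k (Cone k)ᵐᵒᵖ c • f.hom p =
      Cone.transposeEquiv k (algebraMap k (Cone k) c) • f.hom p
    rw [Cone.transposeEquiv_algebraMap]

instance : (ModuleCat.restrictScalars.{u} (Cone.transposeEquiv k).symm.toRingHom).Linear k where
  map_smul f c := by
    ext p
    change algebraMap k (Cone k) c • f.hom p =
      (Cone.transposeEquiv k).symm (algebraMap k (Cone k)ᵐᵒᵖ c) • f.hom p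
    rw [← Cone.transposeEquiv_algebraMap, RingEquiv.symm_apply_apply]

instance : (twist k θ).Linear k := by
  unfold twist; infer_instance

end Twist

/-! ## Dg categories -/

/-- A dg category over `k`: a category enriched over (unbounded, cohomologically graded)
complexes of `k`-modules. The complexes of morphisms are given by their components
`Hom x y n`, `n : ℤ`, and differentials `d : Hom x y n → Hom x y m`, where `n + 1 = m`.
The composition is a family of bilinear maps; `comp h f g` stands for `g ∘ f`, and the Leibniz
rule is `d (g ∘ f) = d g ∘ f + (-1) ^ |g| g ∘ d f`. -/
class DGCategory (k : Type u) [CommRing k] (A : Type w) where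
  /-- The degree `n` component of the complex of morphisms from `x` to `y`. -/
  Hom : A → A → ℤ → Type v
  [addCommGroup : ∀ x y n, AddCommGroup (Hom x y n)]
  [module : ∀ x y n, Module k (Hom x y n)]
  /-- The differential. -/
  d : ∀ {x y : A} {n m : ℤ}, n + 1 = m → Hom x y n →ₗ[k] Hom x y m
  /-- The composition, in diagrammatic order. -/
  comp : ∀ {x y z : A} {n m l : ℤ}, n + m = l → Hom x y n →ₗ[k] Hom y z m →ₗ[k] Hom x z l
  /-- The identity morphisms. -/
  id : ∀ x : A, Hom x x 0
  d_d : ∀ {x y : A} {n m l : ℤ} (h : n + 1 = m) (h' : m + 1 = l) (f : Hom x y n),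
    d h' (d h f) = 0
  d_id : ∀ x : A, d (zero_add 1) (id x) = 0
  id_comp : ∀ {x y : A} {n : ℤ} (f : Hom x y n), comp (zero_add n) (id x) f = f
  comp_id : ∀ {x y : A} {n : ℤ} (f : Hom x y n), comp (add_zero n) f (id y) = f
  assoc : ∀ {x y z t : A} {n m l nm ml nml : ℤ} (h₁ : n + m = nm) (h₂ : nm + l = nml)
    (h₃ : m + l = ml) (h₄ : n + ml = nml) (f : Hom x y n) (g : Hom y z m) (e : Hom z t l),
    comp h₂ (comp h₁ f g) e = comp h₄ f (comp h₃ g e)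
  leibniz : ∀ {x y z : A} {n m l n' m' l' : ℤ} (h : n + m = l) (hn : n + 1 = n')
    (hm : m + 1 = m') (hl : l + 1 = l') (h₁ : n + m' = l') (h₂ : n' + m = l')
    (f : Hom x y n) (g : Hom y z m),
    d hl (comp h f g) = comp h₁ f (d hm g) + m.negOnePow • comp h₂ (d hn f) g

attribute [reducible, instance] DGCategory.addCommGroup DGCategory.module

/-- A dg functor. -/
structure DGFunctor (k : Type u) [CommRing k] (A : Type w₁) (B : Type w₂)
    [DGCategory.{v₁} k A] [DGCategory.{v₂} k B] where
  /-- The action on objects. -/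
  obj : A → B
  /-- The action on complexes of morphisms. -/
  map : ∀ {x y : A} {n : ℤ},
    DGCategory.Hom k x y n →ₗ[k] DGCategory.Hom k (obj x) (obj y) n
  map_d : ∀ {x y : A} {n m : ℤ} (h : n + 1 = m) (f : DGCategory.Hom k x y n),
    map (DGCategory.d h f) = DGCategory.d h (map f)
  map_id : ∀ x : A, map (DGCategory.id (k := k) x) = DGCategory.id (obj x)
  map_comp : ∀ {x y z : A} {n m l : ℤ} (h : n + m = l) (f : DGCategory.Hom k x y n)
    (g : DGCategory.Hom k y z m),
    map (DGCategory.comp h f g) = DGCategory.comp h (map f) (map g)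

/-- A natural isomorphism of dg functors: a family of closed morphisms of degree zero which
are invertible, and natural with respect to morphisms of all degrees. -/
structure DGNatIso {k : Type u} [CommRing k] {A : Type w₁} {B : Type w₂}
    [DGCategory.{v₁} k A] [DGCategory.{v₂} k B] (F G : DGFunctor k A B) where
  /-- The components. -/
  hom : ∀ x : A, DGCategory.Hom k (F.obj x) (G.obj x) 0
  /-- The components of the inverse. -/
  inv : ∀ x : A, DGCategory.Hom k (G.obj x) (F.obj x) 0
  d_hom : ∀ x : A, DGCategory.d (zero_add 1) (hom x) = 0
  d_inv : ∀ x : A, DGCategory.d (zero_add 1) (inv x) = 0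
  hom_inv_id : ∀ x : A,
    DGCategory.comp (add_zero 0) (hom x) (inv x) = DGCategory.id (F.obj x)
  inv_hom_id : ∀ x : A,
    DGCategory.comp (add_zero 0) (inv x) (hom x) = DGCategory.id (G.obj x)
  naturality : ∀ {x y : A} {n : ℤ} (f : DGCategory.Hom k x y n),
    DGCategory.comp (add_zero n) (F.map f) (hom y) =
      DGCategory.comp (zero_add n) (hom x) (G.map f)

/-- A dg adjunction `L ⊣ R`: isomorphisms of complexes `B(L x, y) ≃ A(x, R y)`, natural in
both variables with respect to morphisms of all degrees. -/
structure DGAdjunction {k : Type u} [CommRing k] {A : Type w₁} {B : Type w₂}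
    [DGCategory.{v₁} k A] [DGCategory.{v₂} k B] (L : DGFunctor k A B) (R : DGFunctor k B A) where
  /-- The isomorphism of complexes of morphisms. -/
  homEquiv : ∀ (x : A) (y : B) (n : ℤ),
    DGCategory.Hom k (L.obj x) y n ≃ₗ[k] DGCategory.Hom k x (R.obj y) n
  homEquiv_d : ∀ {x : A} {y : B} {n m : ℤ} (h : n + 1 = m) (f : DGCategory.Hom k (L.obj x) y n),
    homEquiv x y m (DGCategory.d h f) = DGCategory.d h (homEquiv x y n f)
  homEquiv_naturality_left : ∀ {x x' : A} {y : B} {n m l : ℤ} (h : n + m = l)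
    (f : DGCategory.Hom k x' x n) (g : DGCategory.Hom k (L.obj x) y m),
    homEquiv x' y l (DGCategory.comp h (L.map f) g) =
      DGCategory.comp h f (homEquiv x y m g)
  homEquiv_naturality_right : ∀ {x : A} {y y' : B} {n m l : ℤ} (h : n + m = l)
    (f : DGCategory.Hom k (L.obj x) y n) (g : DGCategory.Hom k y y' m),
    homEquiv x y' l (DGCategory.comp h f g) =
      DGCategory.comp h (homEquiv x y n f) (R.map g)

/-- The product of two dg categories. -/
instance DGCategory.prod (k : Type u) [CommRing k] (A : Type w₁) (B : Type w₂)
    [DGCategory.{v₁} k A] [DGCategory.{v₂} k B] : DGCategory.{max v₁ v₂} k (A × B) where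
  Hom x y n := DGCategory.Hom k x.1 y.1 n × DGCategory.Hom k x.2 y.2 n
  d h := LinearMap.prodMap (DGCategory.d h) (DGCategory.d h)
  comp h := LinearMap.mk₂ k
    (fun f g => (DGCategory.comp h f.1 g.1, DGCategory.comp h f.2 g.2))
    (fun _ _ _ => by simp) (fun _ _ _ => by simp) (fun _ _ _ => by simp) (fun _ _ _ => by simp)
  id x := (DGCategory.id x.1, DGCategory.id x.2)
  d_d h h' f := Prod.ext (DGCategory.d_d h h' f.1) (DGCategory.d_d h h' f.2)
  d_id x := Prod.ext (DGCategory.d_id x.1) (DGCategory.d_id x.2)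
  id_comp f := Prod.ext (DGCategory.id_comp f.1) (DGCategory.id_comp f.2)
  comp_id f := Prod.ext (DGCategory.comp_id f.1) (DGCategory.comp_id f.2)
  assoc h₁ h₂ h₃ h₄ f g e := Prod.ext (DGCategory.assoc h₁ h₂ h₃ h₄ f.1 g.1 e.1)
    (DGCategory.assoc h₁ h₂ h₃ h₄ f.2 g.2 e.2)
  leibniz h hn hm hl h₁ h₂ f g := Prod.ext (DGCategory.leibniz h hn hm hl h₁ h₂ f.1 g.1)
    (DGCategory.leibniz h hn hm hl h₁ h₂ f.2 g.2)

/-- The full dg subcategory of the objects with a given property. -/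
instance DGCategory.fullSubcategory (k : Type u) [CommRing k] (A : Type w)
    [DGCategory.{v} k A] (p : A → Prop) : DGCategory.{v} k {x : A // p x} where
  Hom x y n := DGCategory.Hom k x.1 y.1 n
  d h := DGCategory.d h
  comp h := DGCategory.comp h
  id x := DGCategory.id x.1
  d_d := DGCategory.d_d
  d_id x := DGCategory.d_id x.1
  id_comp := DGCategory.id_comp
  comp_id := DGCategory.comp_id
  assoc := DGCategory.assoc
  leibniz := DGCategory.leibniz

namespace DGFunctor

variable (k : Type u) [CommRing k] {A : Type w₁} {B : Type w₂} {C : Type w₃}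
  [DGCategory.{v₁} k A] [DGCategory.{v₂} k B] [DGCategory.{v₃} k C]

/-- The identity dg functor. -/
def id (A : Type w₁) [DGCategory.{v₁} k A] : DGFunctor k A A where
  obj x := x
  map := LinearMap.id
  map_d _ _ := rfl
  map_id _ := rfl
  map_comp _ _ _ := rfl

/-- The inclusion of a full dg subcategory. -/
def inclusion (A : Type w₁) [DGCategory.{v₁} k A] (p : A → Prop) :
    DGFunctor k {x : A // p x} A where
  obj x := x.1
  map := LinearMap.id
  map_d _ _ := rfl
  map_id _ := rfl
  map_comp _ _ _ := rfl

/-- The diagonal dg functor. -/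
def diagonal (A : Type w₁) [DGCategory.{v₁} k A] : DGFunctor k A (A × A) where
  obj x := (x, x)
  map := LinearMap.prod LinearMap.id LinearMap.id
  map_d _ _ := rfl
  map_id _ := rfl
  map_comp _ _ _ := rfl

variable {k}

/-- The composition of dg functors, in diagrammatic order. -/
def comp (F : DGFunctor k A B) (G : DGFunctor k B C) : DGFunctor k A C where
  obj x := G.obj (F.obj x)
  map := G.map ∘ₗ F.map
  map_d h f := by simp [F.map_d, G.map_d]
  map_id x := by simp [F.map_id, G.map_id]
  map_comp h f g := by simp [F.map_comp, G.map_comp]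

/-- The dg functor into a product with given components. -/
def pair (F : DGFunctor k A B) (G : DGFunctor k A C) : DGFunctor k A (B × C) where
  obj x := (F.obj x, G.obj x)
  map := LinearMap.prod F.map G.map
  map_d h f := Prod.ext (F.map_d h f) (G.map_d h f)
  map_id x := Prod.ext (F.map_id x) (G.map_id x)
  map_comp h f g := Prod.ext (F.map_comp h f g) (G.map_comp h f g)

end DGFunctor

/-- The category `Z⁰(A)`: the objects of `A`, with closed morphisms of degree zero. -/
structure ZeroCycles (k : Type u) [CommRing k] (A : Type w) where
  /-- The underlying object of `A`. -/
  as : A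

instance (k : Type u) [CommRing k] (A : Type w) [DGCategory.{v} k A] :
    Category.{v} (ZeroCycles k A) where
  Hom x y := {f : DGCategory.Hom k x.as y.as 0 // DGCategory.d (zero_add 1) f = 0}
  id x := ⟨DGCategory.id x.as, DGCategory.d_id x.as⟩
  comp f g := ⟨DGCategory.comp (add_zero 0) f.1 g.1, by
    rw [DGCategory.leibniz (add_zero 0) (zero_add 1) (zero_add 1) (zero_add 1)
      (zero_add 1) (add_zero 1), f.2, g.2]
    simp⟩
  id_comp f := Subtype.ext (DGCategory.id_comp f.1)
  comp_id f := Subtype.ext (DGCategory.comp_id f.1)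
  assoc f g h := Subtype.ext (DGCategory.assoc _ _ _ _ f.1 g.1 h.1)

/-! ## Complexes and perfect complexes -/

section Complexes

open CochainComplex.HomComplex

/-- The dg category of cochain complexes in a `k`-linear category: the degree `n` part of
`Hom(K, L)` is `∏ p, Hom(K^p, L^(p+n))`, and `d f = d_L ∘ f - (-1)^n f ∘ d_K`. -/
noncomputable instance DGCategory.cochainComplex (k : Type u) [CommRing k] (C : Type w)
    [Category.{v} C] [Preadditive C] [Linear k C] :
    DGCategory.{v} k (CochainComplex C ℤ) where
  Hom K L n := Cochain K L n
  d {K L n m} _ := δ_hom k K L n m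
  comp h := LinearMap.mk₂ k (fun f g => f.comp g h)
    (fun _ _ _ => Cochain.add_comp _ _ _ h) (fun _ _ _ => Cochain.smul_comp _ _ _ h)
    (fun _ _ _ => Cochain.comp_add _ _ _ h) (fun _ _ _ => Cochain.comp_smul _ _ _ h)
  id K := Cochain.ofHom (𝟙 K)
  d_d _ _ f := δ_δ _ _ _ f
  d_id K := δ_ofHom (𝟙 K)
  id_comp f := Cochain.id_comp f
  comp_id f := Cochain.comp_id f
  assoc h₁ h₂ h₃ h₄ f g e := Cochain.comp_assoc f g e h₁ h₃ (by rw [h₁, h₂])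
  leibniz h hn hm hl h₁ h₂ f g := δ_comp f g h _ _ _ hl hn hm

/-- The dg functor between dg categories of complexes which applies a `k`-linear functor
degreewise. -/
noncomputable def DGFunctor.ofLinear (k : Type u) [CommRing k] {C : Type w₁} {D : Type w₂}
    [Category.{v₁} C] [Preadditive C] [Linear k C] [Category.{v₂} D] [Preadditive D] [Linear k D]
    (F : C ⥤ D) [F.Additive] [F.Linear k] :
    DGFunctor k (CochainComplex C ℤ) (CochainComplex D ℤ) where
  obj K := (F.mapHomologicalComplex (ComplexShape.up ℤ)).obj K
  map :=
    { toFun := fun f => Cochain.map f F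
      map_add' := fun f g => Cochain.map_add f g F
      map_smul' := fun c f => by
        apply Cochain.ext
        intro p q hpq
        exact Functor.map_smul F c (f.v p q hpq) }
  map_d _ f := (δ_map _ _ f F).symm
  map_id K := by
    change Cochain.map (Cochain.ofHom (𝟙 K)) F = Cochain.ofHom (𝟙 _)
    rw [Cochain.map_ofHom, CategoryTheory.Functor.map_id]
  map_comp h f g := Cochain.map_comp _ f g h F

end Complexes

/-- A complex `P` of `R`-modules is cofibrant for the projective model structure, in which the
weak equivalences are the quasi-isomorphisms and the fibrations are the degreewise surjections:
every morphism from `P` to the target of a surjective quasi-isomorphism `p` lifts along `p`. -/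
def IsCofibrantComplex {R : Type u} [Ring R] (P : CochainComplex (ModuleCat.{u} R) ℤ) : Prop :=
  ∀ ⦃X Y : CochainComplex (ModuleCat.{u} R) ℤ⦄ (p : X ⟶ Y),
    (∀ n, Function.Surjective (p.f n)) → QuasiIso p →
      ∀ f : P ⟶ Y, ∃ g : P ⟶ X, g ≫ p = f

/-- An object `X` of a preadditive category is compact if each morphism from `X` to
a coproduct is a finite sum of morphisms which factor through one of the summands; that is,
if the (automatically injective) map `⨁ Hom(X, Y i) → Hom(X, ∐ Y i)` is bijective. -/
def IsCompactObj {D : Type w} [Category.{v} D] [Preadditive D] (X : D) : Prop :=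
  ∀ (ι : Type u) (Y : ι → D) (c : Limits.Cofan Y), Nonempty (Limits.IsColimit c) →
    ∀ f : X ⟶ c.pt, ∃ (s : Finset ι) (g : ∀ i, X ⟶ Y i), f = ∑ i ∈ s, g i ≫ c.inj i

/-- A perfect complex: a cofibrant complex which is compact in the derived category. -/
def IsPerfect {R : Type u} [Ring R] (P : CochainComplex (ModuleCat.{u} R) ℤ) : Prop :=
  IsCofibrantComplex P ∧
    letI : HasDerivedCategory.{u + 1} (ModuleCat.{u} R) := HasDerivedCategory.standard _
    IsCompactObj.{u + 1, u, u + 1} (DerivedCategory.Q.obj P)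

/-- The category `perf(H)`: the full subcategory of the category of complexes of right
`H`-modules whose objects are the perfect complexes. -/
abbrev Perf (H : Type u) [Ring H] : Type (u + 1) :=
  ObjectProperty.FullSubcategory
    (fun P : CochainComplex (ModuleCat.{u} Hᵐᵒᵖ) ℤ => IsPerfect P)

/-- The objects of the dg category `perf_dg(H)`: the perfect complexes of
right `H`-modules. -/
abbrev PerfDG (H : Type u) [Ring H] : Type (u + 1) :=
  {P : CochainComplex (ModuleCat.{u} Hᵐᵒᵖ) ℤ // IsPerfect P}

/-- The category of right modules over a `k`-algebra is `k`-linear. -/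
noncomputable instance (k : Type u) [CommRing k] (H : Type u) [Ring H] [Algebra k H] :
    Linear k (ModuleCat.{u} Hᵐᵒᵖ) := ModuleCat.Algebra.instLinear

/-- The dg functor on the dg category of complexes of right `Γ`-modules which is given by
tensoring with the twisted bimodule `W`, via the transposition `Γᵒᵖ ≃ Γ`. -/
noncomputable def twistDG (k : Type u) [CommRing k] (θ : ℕ ≃ ℕ × ℕ) :
    DGFunctor k (CochainComplex (ModuleCat.{u} (Cone k)ᵐᵒᵖ) ℤ)
      (CochainComplex (ModuleCat.{u} (Cone k)ᵐᵒᵖ) ℤ) :=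
  DGFunctor.ofLinear k (twist k θ)

/-! The statement is an Eilenberg swindle. Under `θ`, the matrix φ(A) is block diagonal on ℕ × ℕ,
with one copy of A on each layer ℕ × {b}. Splitting off the layer b = 0 and renumbering the others
gives an isomorphism of bimodules Γ ⊕ W ≃ W. Concretely, write S for `Cone.layerZero` and T for
`Cone.layerSucc`. Then S Sᵀ = T Tᵀ = 1, S Tᵀ = T Sᵀ = 0 and Sᵀ S + Tᵀ T = 1, while A S = S φ(A) and
T commutes with every φ(A). Right multiplication by S, T and their transposes yields
`twistedTensorDecomposition`, a natural splitting of W ⊗ - into the identity and W ⊗ - itself.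
Applied degreewise to complexes, it is natural for cochains of every degree
(`FlasqueDecomposition.complexIso_hom_naturality`), so it gives Id ⊕ τ ≃ τ.

The homotopical point is that W ⊗ - preserves perfect complexes. Up to transposition it is left
adjoint to restriction of scalars along φ (`twistedTensorAdjunction`), and this right adjoint is
exact and preserves coproducts. It therefore preserves surjective quasi-isomorphisms, so its left
adjoint preserves cofibrancy (`IsCofibrantComplex.map`). Compactness is transferred by a bijection
between morphisms in the two derived categories (`CategoryTheory.Adjunction.derivedHom_bijective`).
This needs two facts: cofibrant complexes are K-projective (`IsCofibrantComplex.isKProjective`), and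
coproducts of complexes remain coproducts in the derived category
(`DerivedCategory.isColimitCoproduct`).

The remaining claims are formal: sums are biproducts of complexes, and a closed cochain of degree
zero is a morphism of complexes. -/

/-! ### Null-homotopies as lifts, and K-projectivity of cofibrant complexes -/

section NullHomotopic

open Limits CochainComplex HomComplex

variable {C : Type w} [Category.{v} C] [Preadditive C] [HasBinaryBiproducts C]

/-- The mapping cocone of the identity is contractible. -/
noncomputable def CochainComplex.mappingCocone.homotopyToZeroOfId (K : CochainComplex C ℤ) :
    Homotopy (𝟙 (mappingCocone (𝟙 K))) 0 :=
  (Homotopy.ofEq (by simp; rfl)).trans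
    (((mappingCone.homotopyToZeroOfId K).shift (-1)).trans
      (Homotopy.ofEq (by simp; rfl)))

/-- A morphism is homotopic to zero if and only if it lifts to the contractible mapping cocone
of the identity of its target. -/
theorem CochainComplex.nonempty_homotopy_zero_iff_lifts {K L : CochainComplex C ℤ} (f : K ⟶ L) :
    Nonempty (Homotopy f 0) ↔ ∃ g : K ⟶ mappingCocone (𝟙 L), g ≫ mappingCocone.fst (𝟙 L) = f := by
  constructor
  · rintro ⟨h⟩
    obtain ⟨z, hz⟩ := Cochain.equivHomotopy _ _ h
    -- Here f = δ z, whereas the second component β of a lift to the cocone must satisfy δ β + f =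
    -- 0; hence the sign.
    refine ⟨mappingCocone.lift (𝟙 L) f (-z) ?_, mappingCocone.lift_fst _ _ _ _⟩
    rw [Cochain.ofHom_zero, add_zero] at hz
    rw [δ_neg, Category.comp_id, hz, neg_add_cancel]
  · rintro ⟨g, rfl⟩
    exact ⟨(Homotopy.ofEq (by simp)).trans
      ((((mappingCocone.homotopyToZeroOfId L).compRight (mappingCocone.fst (𝟙 L))).compLeft g).trans
        (Homotopy.ofEq (by simp)))⟩

end NullHomotopic

section KProjective

open Limits CochainComplex

variable {C : Type w} [Category.{v} C] [Abelian C]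

theorem CochainComplex.acyclic_mappingCocone_id (K : CochainComplex C ℤ) :
    (mappingCocone (𝟙 K)).Acyclic := by
  intro n
  rw [HomologicalComplex.exactAt_iff_isZero_homology, IsZero.iff_id_eq_zero,
    ← HomologicalComplex.homologyMap_id,
    (mappingCocone.homotopyToZeroOfId K).homologyMap_eq n, HomologicalComplex.homologyMap_zero]

/-- For L acyclic, the projection to L from the cocone of its identity is degreewise split epi, and
it is a quasi-isomorphism because both complexes are acyclic. The lift of f provided by cofibrancy
is then exactly a null-homotopy. -/
theorem IsCofibrantComplex.isKProjective {R : Type u} [Ring R]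
    {P : CochainComplex (ModuleCat.{u} R) ℤ} (hP : IsCofibrantComplex P) : P.IsKProjective where
  nonempty_homotopy_zero {L} f hL := by
    rw [nonempty_homotopy_zero_iff_lifts]
    refine hP _ (fun n => ?_) ⟨fun n => ?_⟩ f
    · rw [← ModuleCat.epi_iff_surjective]
      exact epi_of_epi_fac (mappingCocone.inl_v_fst_f (𝟙 L) n)
    · rw [quasiIsoAt_iff_exactAt _ _ (acyclic_mappingCocone_id L n)]
      exact hL n

end KProjective

/-! ### Coproducts of complexes -/

section Coproducts

open Limits HomologicalComplex

variable {C : Type w} [Category.{v} C] [Abelian C]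

/-- Quasi-isomorphisms of complexes of functors are detected pointwise. -/
theorem HomologicalComplex.quasiIso_of_evaluation {J : Type w₁} [Category.{v₁} J] {ι : Type w₂}
    {c : ComplexShape ι} {K L : HomologicalComplex (J ⥤ C) c} (f : K ⟶ L)
    (hf : ∀ j : J, QuasiIso ((((evaluation J C).obj j).mapHomologicalComplex c).map f)) :
    QuasiIso f where
  quasiIsoAt n := by
    rw [quasiIsoAt_iff_isIso_homologyMap, NatTrans.isIso_iff_isIso_app]
    intro j
    have h := (hf j).quasiIsoAt n
    rw [quasiIsoAt_iff, ShortComplex.quasiIso_iff] at h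
    -- Evaluation at `j` is exact, hence commutes with homology.
    exact (NatIso.isIso_map_iff (ShortComplex.homologyFunctorIso ((evaluation J C).obj j))
      ((shortComplexFunctor _ c n).map f)).1 h

variable {ι : Type w₁}

/-- A family of complexes, as a complex of functors. -/
@[simps]
def CochainComplex.ofFamily (Z : ι → CochainComplex C ℤ) :
    CochainComplex (Discrete ι ⥤ C) ℤ where
  X n := Discrete.functor fun i => (Z i).X n
  d n m := Discrete.natTrans fun i => (Z i.as).d n m
  shape n m h := by ext i; exact (Z i.as).shape n m h
  d_comp_d' n m l _ _ := by ext i; exact (Z i.as).d_comp_d n m l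

/-- A family of morphisms of complexes, as a morphism of complexes of functors. -/
@[simps]
def CochainComplex.ofFamilyMap {Z Z' : ι → CochainComplex C ℤ} (s : ∀ i, Z i ⟶ Z' i) :
    CochainComplex.ofFamily Z ⟶ CochainComplex.ofFamily Z' where
  f n := Discrete.natTrans fun i => (s i.as).f n
  comm' n m _ := by ext i; exact (s i.as).comm n m

variable [HasColimitsOfShape (Discrete ι) C]

/-- The coproduct of a family of complexes. -/
noncomputable def CochainComplex.coproduct (Z : ι → CochainComplex C ℤ) : CochainComplex C ℤ :=
  ((colim (J := Discrete ι) (C := C)).mapHomologicalComplex _).obj (CochainComplex.ofFamily Z)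

/-- The morphism of coproducts induced by a family of morphisms of complexes. -/
noncomputable def CochainComplex.coproductMap {Z Z' : ι → CochainComplex C ℤ}
    (s : ∀ i, Z i ⟶ Z' i) : CochainComplex.coproduct Z ⟶ CochainComplex.coproduct Z' :=
  ((colim (J := Discrete ι) (C := C)).mapHomologicalComplex _).map (CochainComplex.ofFamilyMap s)

/-- The inclusion of a summand in the coproduct. -/
noncomputable def CochainComplex.coproductι (Z : ι → CochainComplex C ℤ) (i : ι) :
    Z i ⟶ CochainComplex.coproduct Z where
  f n := colimit.ι (Discrete.functor fun i => (Z i).X n) ⟨i⟩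
  comm' n m _ := ι_colimMap ((CochainComplex.ofFamily Z).d n m) ⟨i⟩

theorem CochainComplex.coproductι_map {Z Z' : ι → CochainComplex C ℤ}
    (s : ∀ i, Z i ⟶ Z' i) (i : ι) :
    CochainComplex.coproductι Z i ≫ CochainComplex.coproductMap s =
      s i ≫ CochainComplex.coproductι Z' i := by
  ext n
  exact ι_colimMap ((CochainComplex.ofFamilyMap s).f n) ⟨i⟩

/-- The universal property of the coproduct of complexes. -/
noncomputable def CochainComplex.isColimitCoproduct (Z : ι → CochainComplex C ℤ) :
    IsColimit (Cofan.mk _ (CochainComplex.coproductι Z)) :=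
  isColimitOfEval _ _ fun n =>
    IsColimit.ofIsoColimit ((IsColimit.precomposeHomEquiv
      (Discrete.natIso fun _ => Iso.refl _ :
        Discrete.functor Z ⋙ eval C _ n ≅ Discrete.functor fun i => (Z i).X n) _).symm
        (colimit.isColimit _))
      (Cocone.ext (Iso.refl _) fun ⟨i⟩ => by
        dsimp [CochainComplex.coproductι]
        exact (Category.comp_id _).trans (Category.id_comp _))

/-- The family is a quasi-isomorphism of complexes in the functor category, and the exact functor
`colim` preserves it. -/
theorem CochainComplex.quasiIso_coproductMap [HasExactColimitsOfShape (Discrete ι) C]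
    {Z Z' : ι → CochainComplex C ℤ}
    (s : ∀ i, Z i ⟶ Z' i) (hs : ∀ i, QuasiIso (s i)) :
    QuasiIso (CochainComplex.coproductMap s) := by
  have : QuasiIso (CochainComplex.ofFamilyMap s) :=
    quasiIso_of_evaluation _ fun i => hs i.as
  exact quasiIso_map_of_preservesHomology _ _

end Coproducts

/-! ### Coproducts in the derived category -/

section DerivedCoproducts

open Limits CochainComplex DerivedCategory

variable {C : Type w} [Category.{v} C] [Abelian C] [HasDerivedCategory.{w₂} C]

/-- A morphism of complexes which vanishes in the derived category becomes homotopic to zero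
after composition with a quasi-isomorphism. -/
theorem DerivedCategory.exists_quasiIso_of_Q_map_eq_zero {K L : CochainComplex C ℤ} (f : K ⟶ L)
    (hf : Q.map f = 0) : ∃ (K' : CochainComplex C ℤ) (s : K' ⟶ K), QuasiIso s ∧
      Nonempty (Homotopy (s ≫ f) 0) := by
  have h : Qh.map ((HomotopyCategory.quotient _ _).map f) = Qh.map 0 := by
    rw [Functor.map_zero]
    have := quotientCompQhIso_hom_naturality f
    rw [hf, comp_zero] at this
    exact (cancel_mono _).1 (this.trans zero_comp.symm)
  rw [MorphismProperty.map_eq_iff_precomp Qh (HomotopyCategory.quasiIso C (.up ℤ))] at h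
  obtain ⟨K', s, hs, h⟩ := h
  obtain ⟨K', rfl⟩ := HomotopyCategory.quotient_obj_surjective K'
  obtain ⟨s, rfl⟩ := (HomotopyCategory.quotient _ _).map_surjective s
  rw [← isIso_Qh_map_iff] at hs
  refine ⟨K', s, (isIso_Q_map_iff_quasiIso C s).1 hs, ⟨HomotopyCategory.homotopyOfEq _ _ ?_⟩⟩
  rw [Functor.map_comp, h, comp_zero, Functor.map_zero]

variable {ι : Type w₁} [HasColimitsOfShape (Discrete ι) C]
  [HasExactColimitsOfShape (Discrete ι) C]

/-- A difference of two such morphisms is a fraction whose numerator g vanishes in the derived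
category on each summand, hence is null-homotopic there after a quasi-isomorphism tᵢ.
Null-homotopies being lifts to a cocone, they assemble by the universal property of the coproduct,
and the coproduct of the tᵢ is again a quasi-isomorphism. -/
theorem DerivedCategory.coproduct_hom_ext {Z : ι → CochainComplex C ℤ} {Y : DerivedCategory C}
    {f g : Q.obj (coproduct Z) ⟶ Y}
    (h : ∀ i, Q.map (coproductι Z i) ≫ f = Q.map (coproductι Z i) ≫ g) : f = g := by
  rw [← sub_eq_zero]
  replace h i : Q.map (coproductι Z i) ≫ (f - g) = 0 := by rw [Preadditive.comp_sub, h, sub_self]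
  generalize f - g = f at h
  obtain ⟨T, ⟨e⟩⟩ := Functor.EssSurj.mem_essImage (F := Q (C := C)) Y
  rw [← cancel_mono e.inv, zero_comp]
  replace h i : Q.map (coproductι Z i) ≫ f ≫ e.inv = 0 := by rw [reassoc_of% h i, zero_comp]
  generalize f ≫ e.inv = f at h
  obtain ⟨T', g, s, hs, rfl⟩ := left_fac f
  replace h i : Q.map (coproductι Z i ≫ g) = 0 := by
    rw [Functor.map_comp, ← cancel_mono (inv (Q.map s)), Category.assoc, h, zero_comp]
  choose Z' t ht H using fun i => exists_quasiIso_of_Q_map_eq_zero _ (h i)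
  simp only [nonempty_homotopy_zero_iff_lifts] at H
  choose H hH using H
  have := quasiIso_coproductMap t ht
  have key : Nonempty (Homotopy (coproductMap t ≫ g) 0) := by
    rw [nonempty_homotopy_zero_iff_lifts]
    refine ⟨Cofan.IsColimit.desc (isColimitCoproduct Z') H,
      Cofan.IsColimit.hom_ext (isColimitCoproduct Z') _ _ fun i => ?_⟩
    have := Cofan.IsColimit.fac_assoc (isColimitCoproduct Z') H i (mappingCocone.fst (𝟙 T'))
    refine this.trans ((hH i).trans ?_)
    exact (((coproductι_map t i) =≫ g).trans (Category.assoc _ _ _)).symm.trans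
      (Category.assoc _ _ _)
  obtain ⟨key⟩ := key
  have e := Q_map_eq_of_homotopy C key
  rw [Functor.map_comp, Functor.map_zero] at e
  rw [(cancel_epi (Q.map (coproductMap t))).1 (e.trans comp_zero.symm), zero_comp]

/-- Each component is a fraction bᵢ tᵢ⁻¹. The coproduct of the denominators is a quasi-isomorphism
and serves as a common denominator. -/
theorem DerivedCategory.exists_coproduct_desc {Z : ι → CochainComplex C ℤ} {Y : DerivedCategory C}
    (a : ∀ i, Q.obj (Z i) ⟶ Y) :
    ∃ f : Q.obj (coproduct Z) ⟶ Y, ∀ i, Q.map (coproductι Z i) ≫ f = a i := by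
  obtain ⟨T, ⟨e⟩⟩ := Functor.EssSurj.mem_essImage (F := Q (C := C)) Y
  choose Z' t ht b hb using fun i => right_fac (a i ≫ e.inv)
  have := quasiIso_coproductMap t fun i => (isIso_Q_map_iff_quasiIso C (t i)).1 (ht i)
  refine ⟨inv (Q.map (coproductMap t)) ≫
    Q.map (Cofan.IsColimit.desc (isColimitCoproduct Z') b) ≫ e.hom, fun i => ?_⟩
  rw [← cancel_mono e.inv, hb i, ← cancel_epi (Q.map (t i)), IsIso.hom_inv_id_assoc]
  simp only [Category.assoc, Iso.hom_inv_id, Category.comp_id]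
  rw [← Functor.map_comp_assoc, ← coproductι_map, Functor.map_comp_assoc,
    IsIso.hom_inv_id_assoc, ← Functor.map_comp]
  exact congrArg Q.map (Cofan.IsColimit.fac (isColimitCoproduct Z') b i)

/-- The coproduct of complexes is a coproduct in the derived category. -/
noncomputable def DerivedCategory.isColimitCoproduct (Z : ι → CochainComplex C ℤ) :
    IsColimit (Cofan.mk (Q.obj (coproduct Z)) fun i => Q.map (coproductι Z i)) :=
  Cofan.IsColimit.mk _ (fun c => (exists_coproduct_desc c.inj).choose)
    (fun c => (exists_coproduct_desc c.inj).choose_spec)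
    (fun c _ hf => coproduct_hom_ext fun i =>
      (hf i).trans ((exists_coproduct_desc c.inj).choose_spec i).symm)

instance : PreservesColimitsOfShape (Discrete ι) (Q (C := C)) :=
  have (Z : ι → CochainComplex C ℤ) : PreservesColimit (Discrete.functor Z) (Q (C := C)) :=
    preservesColimit_of_preserves_colimit_cocone (CochainComplex.isColimitCoproduct Z)
      ((isColimitMapCoconeCofanMkEquiv Q Z (coproductι Z)).symm
        (DerivedCategory.isColimitCoproduct Z))
  preservesColimitsOfShape_of_discrete _

end DerivedCoproducts

/-! ### Adjunctions on complexes and on derived categories -/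

section AdjunctionComplexes

variable {C : Type w₁} [Category.{v₁} C] [Preadditive C]
  {D : Type w₂} [Category.{v₂} D] [Preadditive D]

/-- The adjunction on complexes induced by an adjunction of additive functors. -/
@[simps]
def CategoryTheory.Adjunction.onComplexes {F : C ⥤ D} {G : D ⥤ C} [F.Additive] [G.Additive]
    (adj : F ⊣ G) {ι : Type w} (c : ComplexShape ι) :
    F.mapHomologicalComplex c ⊣ G.mapHomologicalComplex c where
  unit :=
    { app K := { f n := adj.unit.app (K.X n)
                 comm' _ _ _ := (adj.unit.naturality _).symm }
      naturality _ _ f := by ext n; exact adj.unit.naturality (f.f n) }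
  counit :=
    { app K := { f n := adj.counit.app (K.X n)
                 comm' _ _ _ := (adj.counit.naturality _).symm }
      naturality _ _ f := by ext n; exact adj.counit.naturality (f.f n) }
  left_triangle_components K := by ext n; exact adj.left_triangle_components (K.X n)
  right_triangle_components K := by ext n; exact adj.right_triangle_components (K.X n)

end AdjunctionComplexes

section DerivedAdjunction

open Limits DerivedCategory

variable {C : Type w₁} [Category.{v₁} C] [Abelian C] [HasDerivedCategory.{w₃} C]
  {D : Type w₂} [Category.{v₂} D] [Abelian D] [HasDerivedCategory.{w} D]

/-- Out of a K-projective complex, morphisms in the derived category are the same as homotopy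
classes. This is the surjective half; the next lemma is the injective one. -/
theorem CochainComplex.IsKProjective.Q_map_surjective (K L : CochainComplex C ℤ)
    [K.IsKProjective] : Function.Surjective (Q.map : (K ⟶ L) → _) := by
  intro f
  obtain ⟨g, hg⟩ := (Qh_map_bijective K ((HomotopyCategory.quotient _ _).obj L)).surjective
    ((quotientCompQhIso C).hom.app K ≫ f ≫ (quotientCompQhIso C).inv.app L)
  obtain ⟨g, rfl⟩ := (HomotopyCategory.quotient _ _).map_surjective g
  refine ⟨g, ?_⟩
  rw [← cancel_epi ((quotientCompQhIso C).hom.app K), ← quotientCompQhIso_hom_naturality g]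
  exact (hg =≫ _).trans (by simp)

theorem CochainComplex.IsKProjective.nonempty_homotopy_zero_of_Q_map {K L : CochainComplex C ℤ}
    [K.IsKProjective] {f : K ⟶ L} (hf : Q.map f = 0) : Nonempty (Homotopy f 0) := by
  refine ⟨HomotopyCategory.homotopyOfEq _ _ ((Qh_map_bijective K _).injective ?_)⟩
  rw [Functor.map_zero, Functor.map_zero]
  have := quotientCompQhIso_hom_naturality f
  rw [hf, comp_zero] at this
  exact (cancel_mono _).1 (this.trans zero_comp.symm)

/-- Every family in the derived category is represented by a family of complexes. Its coproduct is
the coproduct of complexes, which is respected by G degreewise and then by `Q`. -/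
theorem CategoryTheory.Functor.preservesColimitsOfShape_mapDerivedCategory (G : D ⥤ C) [G.Additive]
    [PreservesFiniteLimits G] [PreservesFiniteColimits G] (ι : Type v)
    [HasColimitsOfShape (Discrete ι) C] [HasExactColimitsOfShape (Discrete ι) C]
    [HasColimitsOfShape (Discrete ι) D] [HasExactColimitsOfShape (Discrete ι) D]
    [PreservesColimitsOfShape (Discrete ι) G] :
    PreservesColimitsOfShape (Discrete ι) G.mapDerivedCategory := by
  have (Y : ι → DerivedCategory D) :
      PreservesColimit (Discrete.functor Y) G.mapDerivedCategory := by
    choose Z e using fun i => Functor.EssSurj.mem_essImage (F := Q (C := D)) (Y i)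
    have h : PreservesColimit (Discrete.functor Z ⋙ Q) G.mapDerivedCategory := by
      refine preservesColimit_of_preserves_colimit_cocone
        (isColimitOfPreserves Q (CochainComplex.isColimitCoproduct Z)) ?_
      have : PreservesColimit (Discrete.functor Z) (Q ⋙ G.mapDerivedCategory) :=
        preservesColimit_of_natIso _ G.mapDerivedCategoryFactors.symm
      exact isColimitOfPreserves (Q ⋙ G.mapDerivedCategory) (CochainComplex.isColimitCoproduct Z)
    exact preservesColimit_of_iso_diagram _
      (Discrete.natIso fun i => (e i.as).some : Discrete.functor Z ⋙ Q ≅ Discrete.functor Y)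
  exact preservesColimitsOfShape_of_discrete _

/-- For a K-projective complex `K` which is mapped to a K-projective complex by a left adjoint
functor `F`, morphisms out of `F(K)` in the derived category correspond to morphisms from `K` to
the image by the right adjoint. -/
theorem CategoryTheory.Adjunction.derivedHom_bijective {F : C ⥤ D} {G : D ⥤ C}
    [F.Additive] [G.Additive] [PreservesFiniteLimits G] [PreservesFiniteColimits G] (adj : F ⊣ G)
    (K : CochainComplex C ℤ) [K.IsKProjective]
    [CochainComplex.IsKProjective ((F.mapHomologicalComplex _).obj K)] (Y : DerivedCategory D) :
    Function.Bijective fun f : Q.obj ((F.mapHomologicalComplex _).obj K) ⟶ Y =>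
      Q.map ((adj.onComplexes _).unit.app K) ≫ G.mapDerivedCategoryFactors.inv.app _ ≫
        G.mapDerivedCategory.map f := by
  obtain ⟨T, ⟨e⟩⟩ := Functor.EssSurj.mem_essImage (F := Q (C := D)) Y
  -- On morphisms coming from complexes, the map is the adjunction bijection for complexes.
  have key (g : (F.mapHomologicalComplex _).obj K ⟶ T) :
      Q.map ((adj.onComplexes _).unit.app K) ≫ G.mapDerivedCategoryFactors.inv.app _ ≫
        G.mapDerivedCategory.map (Q.map g) =
      Q.map ((adj.onComplexes _).homEquiv K T g) ≫ G.mapDerivedCategoryFactors.inv.app T := by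
    rw [Adjunction.homEquiv_unit, Functor.map_comp, Category.assoc]
    congr 1
    exact (G.mapDerivedCategoryFactors.inv.naturality g).symm
  constructor
  · intro f f' hff
    rw [← sub_eq_zero]
    have h : Q.map ((adj.onComplexes _).unit.app K) ≫ G.mapDerivedCategoryFactors.inv.app _ ≫
        G.mapDerivedCategory.map ((f - f') ≫ e.inv) = 0 := by
      rw [Functor.map_comp, Functor.map_sub]
      simp only [Preadditive.comp_sub, Preadditive.sub_comp, sub_eq_zero]
      simpa using hff =≫ G.mapDerivedCategory.map e.inv
    rw [← cancel_mono e.inv, zero_comp]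
    generalize (f - f') ≫ e.inv = g at h
    obtain ⟨g, rfl⟩ := CochainComplex.IsKProjective.Q_map_surjective _ _ g
    rw [key, ← zero_comp, cancel_mono] at h
    obtain ⟨H⟩ := CochainComplex.IsKProjective.nonempty_homotopy_zero_of_Q_map h
    -- The adjunct of g is null-homotopic because K is K-projective. Applying F to the homotopy and
    -- composing with the counit gives a null-homotopy of g itself.
    have H' := (F.mapHomotopy H).compRight ((adj.onComplexes _).counit.app T)
    have := Q_map_eq_of_homotopy D H'
    refine (congrArg Q.map ?_).trans (this.trans ?_)
    · exact (((adj.onComplexes _).homEquiv K T).symm_apply_apply g).symm.trans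
        ((adj.onComplexes _).homEquiv_counit _ _ _)
    · rw [Functor.map_zero, zero_comp, Functor.map_zero]
  · intro f
    obtain ⟨g, hg⟩ := CochainComplex.IsKProjective.Q_map_surjective K _
      (f ≫ G.mapDerivedCategory.map e.inv ≫ G.mapDerivedCategoryFactors.hom.app T)
    refine ⟨Q.map (((adj.onComplexes _).homEquiv K T).symm g) ≫ e.hom, ?_⟩
    dsimp only
    rw [Functor.map_comp]
    have := key (((adj.onComplexes _).homEquiv K T).symm g)
    rw [Equiv.apply_symm_apply, hg] at this
    rw [reassoc_of% this]
    simp [← Functor.map_comp]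

/-- This is the usual argument that a left adjoint preserves compact objects when its right adjoint
preserves coproducts. No derived functor of F is needed: the bijection `derivedHom_bijective` at the
single complex K suffices. -/
theorem CategoryTheory.Adjunction.isCompactObj_Q_obj {F : C ⥤ D} {G : D ⥤ C}
    [F.Additive] [G.Additive] [PreservesFiniteLimits G] [PreservesFiniteColimits G] (adj : F ⊣ G)
    [∀ ι : Type u, HasColimitsOfShape (Discrete ι) C]
    [∀ ι : Type u, HasExactColimitsOfShape (Discrete ι) C]
    [∀ ι : Type u, HasColimitsOfShape (Discrete ι) D]
    [∀ ι : Type u, HasExactColimitsOfShape (Discrete ι) D]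
    [∀ ι : Type u, PreservesColimitsOfShape (Discrete ι) G]
    (K : CochainComplex C ℤ) [K.IsKProjective]
    [CochainComplex.IsKProjective ((F.mapHomologicalComplex _).obj K)]
    (hK : IsCompactObj.{w₃, u} (Q.obj K)) :
    IsCompactObj.{w, u} (Q.obj ((F.mapHomologicalComplex _).obj K)) := by
  rintro ι Y c ⟨hc⟩ f
  have := G.preservesColimitsOfShape_mapDerivedCategory ι
  have hc' := (isColimitMapCoconeCofanMkEquiv G.mapDerivedCategory Y c.inj)
    (isColimitOfPreserves G.mapDerivedCategory
      (hc.ofIsoColimit (Cocone.ext (Iso.refl _) : c ≅ Cofan.mk c.pt c.inj)))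
  obtain ⟨s, g, hg⟩ := hK ι _ _ ⟨hc'⟩
    (Q.map ((adj.onComplexes _).unit.app K) ≫ G.mapDerivedCategoryFactors.inv.app _ ≫
        G.mapDerivedCategory.map f)
  choose h hh using fun i => (adj.derivedHom_bijective K (Y i)).surjective (g i)
  refine ⟨s, h, (adj.derivedHom_bijective K c.pt).injective ?_⟩
  change _ ≫ _ ≫ _ = _ ≫ _ ≫ _
  rw [hg, Functor.map_sum, Preadditive.comp_sum, Preadditive.comp_sum]
  refine Finset.sum_congr rfl fun i _ => ?_
  rw [← hh i, Functor.map_comp]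
  simp only [Category.assoc]
  rfl

end DerivedAdjunction

/-! ### Stability of compact and perfect objects -/

section Compact

open Limits

variable {D : Type w} [Category.{v} D] [Preadditive D]

theorem IsCompactObj.of_decomposition {X Y Z : D} (hX : IsCompactObj.{v, u} X)
    (hY : IsCompactObj.{v, u} Y) (p : Z ⟶ X) (i : X ⟶ Z) (q : Z ⟶ Y) (j : Y ⟶ Z)
    (h : p ≫ i + q ≫ j = 𝟙 Z) : IsCompactObj.{v, u} Z := by
  classical
  intro ι W c hc f
  obtain ⟨s, a, ha⟩ := hX ι W c hc (i ≫ f)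
  obtain ⟨t, b, hb⟩ := hY ι W c hc (j ≫ f)
  -- The families `a` and `b` are unconstrained outside `s` and `t`, so they are cut off by zero
  -- before summing over the union.
  refine ⟨s ∪ t, fun l => (if l ∈ s then p ≫ a l else 0) + (if l ∈ t then q ≫ b l else 0), ?_⟩
  rw [← Category.id_comp f, ← h, Preadditive.add_comp, Category.assoc, Category.assoc, ha, hb]
  simp [Preadditive.comp_sum, Finset.sum_add_distrib, ite_comp, Finset.sum_ite_mem,
    Finset.union_inter_cancel_left, Finset.union_inter_cancel_right]

end Compact

section Perfect

open Limits

variable {R S : Type u} [Ring R] [Ring S]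

/-- An exact right adjoint preserves surjective quasi-isomorphisms, so the lifting problem for F(P)
transposes to one for P. -/
theorem IsCofibrantComplex.map {F : ModuleCat.{u} R ⥤ ModuleCat.{u} S}
    {G : ModuleCat.{u} S ⥤ ModuleCat.{u} R} [F.Additive] [G.Additive]
    [PreservesFiniteLimits G] [PreservesFiniteColimits G] (adj : F ⊣ G)
    {P : CochainComplex (ModuleCat.{u} R) ℤ} (hP : IsCofibrantComplex P) :
    IsCofibrantComplex ((F.mapHomologicalComplex _).obj P) := by
  intro X Y p hp hp' f
  obtain ⟨g, hg⟩ := hP ((G.mapHomologicalComplex _).map p)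
    (fun n => (ModuleCat.epi_iff_surjective _).1 (by
      have := (ModuleCat.epi_iff_surjective _).2 (hp n)
      exact inferInstanceAs (Epi (G.map (p.f n)))))
    inferInstance ((adj.onComplexes _).homEquiv P Y f)
  refine ⟨((adj.onComplexes _).homEquiv P X).symm g, ?_⟩
  rw [← Adjunction.homEquiv_naturality_right_symm, hg, Equiv.symm_apply_apply]

theorem IsPerfect.map {F : ModuleCat.{u} R ⥤ ModuleCat.{u} S}
    {G : ModuleCat.{u} S ⥤ ModuleCat.{u} R} [F.Additive] [G.Additive]
    [PreservesFiniteLimits G] [PreservesFiniteColimits G]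
    [∀ ι : Type u, PreservesColimitsOfShape (Discrete ι) G] (adj : F ⊣ G)
    {P : CochainComplex (ModuleCat.{u} R) ℤ} (hP : IsPerfect P) :
    IsPerfect ((F.mapHomologicalComplex _).obj P) := by
  have h := hP.1.map adj
  have := hP.1.isKProjective
  have := h.isKProjective
  let : HasDerivedCategory.{u + 1} (ModuleCat.{u} R) := HasDerivedCategory.standard _
  let : HasDerivedCategory.{u + 1} (ModuleCat.{u} S) := HasDerivedCategory.standard _
  exact ⟨h, adj.isCompactObj_Q_obj P hP.2⟩

theorem IsPerfect.biprod {P P' : CochainComplex (ModuleCat.{u} R) ℤ} (hP : IsPerfect P)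
    (hP' : IsPerfect P') : IsPerfect (P ⊞ P') := by
  let : HasDerivedCategory.{u + 1} (ModuleCat.{u} R) := HasDerivedCategory.standard _
  refine ⟨fun X Y p hp hp' f => ?_, ?_⟩
  · obtain ⟨g, hg⟩ := hP.1 p hp hp' (biprod.inl ≫ f)
    obtain ⟨g', hg'⟩ := hP'.1 p hp hp' (biprod.inr ≫ f)
    exact ⟨biprod.desc g g', by apply biprod.hom_ext' <;> simp [hg, hg']⟩
  · let : HasDerivedCategory.{u + 1} (ModuleCat.{u} R) := HasDerivedCategory.standard _
    refine IsCompactObj.of_decomposition hP.2 hP'.2 (DerivedCategory.Q.map biprod.fst)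
      (DerivedCategory.Q.map biprod.inl) (DerivedCategory.Q.map biprod.snd)
      (DerivedCategory.Q.map biprod.inr) ?_
    simp only [← Functor.map_comp, ← Functor.map_add, biprod.total]
    exact DerivedCategory.Q.map_id _

end Perfect

/-! ### Matrix identities behind the isomorphism Γ ⊕ W ≃ W -/

namespace Cone

variable {k : Type u} [CommRing k]

/-- The transposed matrix. -/
def transpose (A : Cone k) : Cone k := mk _ A.isConeMatrix.transpose

@[simp] theorem entry_transpose (A : Cone k) (i j : ℕ) :
    A.transpose.entry i j = A.entry j i := rfl

@[simp] theorem transpose_transpose (A : Cone k) : A.transpose.transpose = A := rfl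

theorem transpose_mul (A B : Cone k) : (A * B).transpose = B.transpose * A.transpose :=
  congrArg MulOpposite.unop ((transposeEquiv k).map_mul A B)

theorem phi_transpose (θ : ℕ ≃ ℕ × ℕ) (A : Cone k) :
    phi θ A.transpose = (phi θ A).transpose := by
  ext i j
  simp only [entry_phi, entry_transpose, eq_comm]

/-- The matrix of an injective map `e : ℕ → ℕ`, with entry `1` at `(i, e i)`. -/
def ofInjective (k : Type u) [CommRing k] (e : ℕ → ℕ) (he : e.Injective) : Cone k :=
  mk (fun i j => if j = e i then 1 else 0) (by
    refine ⟨((Set.finite_singleton (1 : k)).union (Set.finite_singleton 0)).subset ?_, 1,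
      fun i => ?_, fun j => ?_⟩
    · rintro _ ⟨p, rfl⟩
      by_cases h : p.2 = e p.1 <;> simp [h]
    · refine (Set.encard_le_encard (t := {e i}) ?_).trans (by simp)
      intro j hj
      by_contra h
      exact hj (if_neg h)
    · refine Set.encard_le_one_iff.2 fun a b ha hb => he ?_
      have ha' : j = e a := by by_contra h; exact ha (if_neg h)
      have hb' : j = e b := by by_contra h; exact hb (if_neg h)
      exact ha'.symm.trans hb')

variable {e : ℕ → ℕ} (he : e.Injective)

theorem entry_ofInjective (i j : ℕ) :
    (ofInjective k e he).entry i j = if j = e i then 1 else 0 := rfl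

@[simp] theorem entry_ofInjective_mul (A : Cone k) (i j : ℕ) :
    (ofInjective k e he * A).entry i j = A.entry (e i) j := by
  rw [entry_mul_row _ _ i j {e i} fun l hl => by
    by_contra h
    exact hl (if_neg fun h' => h (by simp [h']))]
  simp [entry_ofInjective]

theorem entry_mul_ofInjective_apply (A : Cone k) (i l : ℕ) :
    (A * ofInjective k e he).entry i (e l) = A.entry i l := by
  rw [entry_mul_col _ _ i (e l) {l} fun m hm => by
    by_contra h
    exact hm (if_neg fun h' => h (by simp [he h']))]
  simp [entry_ofInjective]

theorem entry_mul_ofInjective_of_notMem (A : Cone k) (i j : ℕ) (hj : ∀ l, j ≠ e l) :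
    (A * ofInjective k e he).entry i j = 0 := by
  rw [entry_mul_col _ _ i j ∅ fun m hm =>
    (hm (show (ofInjective k e he).entry m j = 0 from if_neg (hj m))).elim]
  simp

theorem ofInjective_mul_transpose :
    ofInjective k e he * (ofInjective k e he).transpose = 1 := by
  ext i j
  simp [entry_ofInjective, entry_one, he.eq_iff]

theorem ofInjective_mul_transpose_eq_zero {f : ℕ → ℕ} (hf : f.Injective)
    (h : ∀ i j, e i ≠ f j) : ofInjective k e he * (ofInjective k f hf).transpose = 0 := by
  ext i j
  simp [entry_ofInjective, h]

/-- For M the matrix of e, the product Mᵀ M is the diagonal projection onto the range of e. The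
ranges of e and f partition ℕ, so the two projections add up to 1. -/
theorem transpose_mul_ofInjective_add {f : ℕ → ℕ} (hf : f.Injective)
    (h : ∀ i j, e i ≠ f j) (h' : ∀ i, (∃ j, i = e j) ∨ ∃ j, i = f j) :
    (ofInjective k e he).transpose * ofInjective k e he +
      (ofInjective k f hf).transpose * ofInjective k f hf = 1 := by
  ext i j
  rw [entry_add]
  obtain ⟨l, rfl⟩ | ⟨l, rfl⟩ := h' j
  · rw [entry_mul_ofInjective_apply, entry_mul_ofInjective_of_notMem _ _ _ _ (h l), add_zero]
    rfl
  · rw [entry_mul_ofInjective_apply,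
      entry_mul_ofInjective_of_notMem _ _ _ _ fun m hm => h m l hm.symm, zero_add]
    rfl

variable (θ : ℕ ≃ ℕ × ℕ)

/-- Hilbert's hotel: ℕ × ℕ is the disjoint union of the layer ℕ × {0} and the injective image of the
shift (a, b) ↦ (a, b + 1). This lemma and the next three record it, transported to ℕ by `θ`. -/
theorem injective_layerZero : Function.Injective fun i => θ.symm (i, 0) :=
  θ.symm.injective.comp fun _ _ h => congrArg Prod.fst h

theorem injective_layerSucc : Function.Injective fun i => θ.symm ((θ i).1, (θ i).2 + 1) := by
  intro a b h
  have h' := θ.symm.injective h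
  exact θ.injective
    (Prod.ext (congrArg Prod.fst h' :) (Nat.succ_injective (congrArg Prod.snd h' :)))

theorem layerZero_ne_layerSucc (i j : ℕ) : θ.symm (i, 0) ≠ θ.symm ((θ j).1, (θ j).2 + 1) :=
  fun h => absurd (congrArg Prod.snd (θ.symm.injective h)) (Nat.succ_ne_zero _).symm

theorem eq_layerZero_or_layerSucc (i : ℕ) :
    (∃ j, i = θ.symm (j, 0)) ∨ ∃ j, i = θ.symm ((θ j).1, (θ j).2 + 1) := by
  obtain ⟨⟨a, b⟩, rfl⟩ := θ.symm.surjective i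
  cases b with
  | zero => exact Or.inl ⟨a, rfl⟩
  | succ b => exact Or.inr ⟨θ.symm (a, b), by simp⟩

/-- The element `w` of `W` with `A w = w φ(A)` which corresponds to the inclusion of `ℕ × {0}`
in `ℕ × ℕ`. -/
def layerZero (k : Type u) [CommRing k] : Cone k := ofInjective k _ (injective_layerZero θ)

/-- The matrix commuting with the image of `φ` which corresponds to the map `(a, b) ↦ (a, b + 1)`
on `ℕ × ℕ`. -/
def layerSucc (k : Type u) [CommRing k] : Cone k := ofInjective k _ (injective_layerSucc θ)

/-- The block of φ(A) on the layer ℕ × {0} is A, and its blocks joining this layer to the others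
vanish. -/
theorem mul_layerZero (A : Cone k) : A * layerZero θ k = layerZero θ k * phi θ A := by
  ext i j
  rw [layerZero, entry_ofInjective_mul, entry_phi]
  obtain ⟨l, rfl⟩ | ⟨l, rfl⟩ := eq_layerZero_or_layerSucc θ j
  · rw [entry_mul_ofInjective_apply (injective_layerZero θ)]
    simp
  · rw [entry_mul_ofInjective_of_notMem _ _ _ _ fun m hm => layerZero_ne_layerSucc θ m l hm.symm]
    simp

/-- φ(A) has the same block on every layer, so it commutes with the shift of layers. -/
theorem phi_mul_layerSucc (A : Cone k) :
    phi θ A * layerSucc θ k = layerSucc θ k * phi θ A := by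
  ext i j
  rw [layerSucc, entry_ofInjective_mul, entry_phi]
  obtain ⟨l, rfl⟩ | ⟨l, rfl⟩ := eq_layerZero_or_layerSucc θ j
  · rw [entry_mul_ofInjective_of_notMem _ _ _ _ (layerZero_ne_layerSucc θ l)]
    simp
  · rw [entry_mul_ofInjective_apply (injective_layerSucc θ), entry_phi]
    simp

/-- Since φ commutes with transposition, this and the next lemma are the transposes of the two
preceding ones. They make the projections of the splitting right linear, as those made the
inclusions. -/
theorem phi_mul_transpose_layerZero (A : Cone k) :
    phi θ A * (layerZero θ k).transpose = (layerZero θ k).transpose * A := by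
  have := congrArg transpose (mul_layerZero θ A.transpose)
  rwa [transpose_mul, transpose_mul, phi_transpose, transpose_transpose, transpose_transpose,
    eq_comm] at this

theorem phi_mul_transpose_layerSucc (A : Cone k) :
    phi θ A * (layerSucc θ k).transpose = (layerSucc θ k).transpose * phi θ A := by
  have := congrArg transpose (phi_mul_layerSucc θ A.transpose)
  rwa [transpose_mul, transpose_mul, phi_transpose, transpose_transpose, eq_comm] at this

end Cone

/-! ### Linear maps into and out of W ⊗_Γ P -/

section Tensor

open TensorProduct

/-- The underlying module of `W ⊗_Γ P`. -/
abbrev TwistedTensor (k : Type u) [CommRing k] (θ : ℕ ≃ ℕ × ℕ) (P : Type u) [AddCommGroup P]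
    [Module (Cone k) P] : Type u :=
  (TwistedBimodule k θ ⊗[ℤ] P) ⧸ tensorRelations (Cone k) (TwistedBimodule k θ) P

namespace TwistedTensor

variable {k : Type u} [CommRing k] (θ : ℕ ≃ ℕ × ℕ)
  {P Q : Type u} [AddCommGroup P] [Module (Cone k) P] [AddCommGroup Q] [Module (Cone k) Q]

/-- The element `x ⊗ p` of `W ⊗_Γ P`. -/
noncomputable def tmul (x : Cone k) (p : P) : TwistedTensor k θ P :=
  Submodule.Quotient.mk ((show TwistedBimodule k θ from x) ⊗ₜ p)

theorem add_tmul (x y : Cone k) (p : P) : tmul θ (x + y) p = tmul θ x p + tmul θ y p :=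
  congrArg Submodule.Quotient.mk
    (TensorProduct.add_tmul (show TwistedBimodule k θ from x) (show TwistedBimodule k θ from y) p)

theorem tmul_add (x : Cone k) (p q : P) : tmul θ x (p + q) = tmul θ x p + tmul θ x q :=
  congrArg Submodule.Quotient.mk
    (TensorProduct.tmul_add (show TwistedBimodule k θ from x) p q)

theorem zero_tmul (p : P) : tmul θ (0 : Cone k) p = 0 :=
  congrArg Submodule.Quotient.mk (TensorProduct.zero_tmul (TwistedBimodule k θ) p)

theorem smul_tmul (a x : Cone k) (p : P) : a • tmul θ x p = tmul θ (a * x) p := rfl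

theorem mul_phi_tmul (x a : Cone k) (p : P) : tmul θ (x * Cone.phi θ a) p = tmul θ x (a • p) :=
  (Submodule.Quotient.eq _).2
    (Submodule.subset_span ⟨(show TwistedBimodule k θ from x), a, p, rfl⟩)

/-- The universal property of `W ⊗_Γ P`. -/
noncomputable def lift (f : Cone k → P → Q) (h_add : ∀ x y p, f (x + y) p = f x p + f y p)
    (h_smul : ∀ a x p, f (a * x) p = a • f x p) (add_h : ∀ x p q, f x (p + q) = f x p + f x q)
    (h : ∀ x a p, f (x * Cone.phi θ a) p = f x (a • p)) : TwistedTensor k θ P →ₗ[Cone k] Q :=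
  Submodule.liftQ _ (TensorProduct.AlgebraTensorModule.lift
    ({ toFun := fun x : TwistedBimodule k θ => (AddMonoidHom.mk' (f x) (add_h x)).toIntLinearMap
       map_add' := fun x y => LinearMap.ext (h_add x y)
       map_smul' := fun a x => LinearMap.ext (h_smul a x) } :
      TwistedBimodule k θ →ₗ[Cone k] P →ₗ[ℤ] Q)) (by
    rw [tensorRelations, Submodule.span_le]
    rintro _ ⟨x, a, p, rfl⟩
    exact LinearMap.mem_ker.2 ((map_sub _ _ _).trans (sub_eq_zero.2 (h x a p))))

theorem hom_ext {f g : TwistedTensor k θ P →ₗ[Cone k] Q}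
    (h : ∀ x p, f (tmul θ x p) = g (tmul θ x p)) : f = g :=
  bimoduleTensor_ext _ _ h

/-- The endomorphism of `W ⊗_Γ P` given by the right multiplication on `W` with a
matrix which commutes with the image of `φ`. -/
noncomputable def mulRight (B : Cone k) (hB : ∀ A, Cone.phi θ A * B = B * Cone.phi θ A)
    (P : Type u) [AddCommGroup P] [Module (Cone k) P] :
    TwistedTensor k θ P →ₗ[Cone k] TwistedTensor k θ P :=
  lift θ (fun x p => tmul θ (x * B) p) (fun x y p => by rw [add_mul, add_tmul])
    (fun a x p => by rw [mul_assoc, smul_tmul]) (fun x p q => tmul_add _ _ _ _)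
    (fun x a p => by rw [mul_assoc, hB, ← mul_assoc, mul_phi_tmul])

/-- The linear map `P → W ⊗_Γ P` given by an element `B` of `W` with `A B = B φ(A)`. -/
noncomputable def inclusion (B : Cone k) (hB : ∀ A, A * B = B * Cone.phi θ A)
    (P : Type u) [AddCommGroup P] [Module (Cone k) P] : P →ₗ[Cone k] TwistedTensor k θ P where
  toFun p := tmul θ B p
  map_add' p q := tmul_add _ _ _ _
  map_smul' a p := by rw [RingHom.id_apply, smul_tmul, hB, mul_phi_tmul]

/-- The linear map `W ⊗_Γ P → P` given by a matrix `B` with `φ(A) B = B A`. -/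
noncomputable def projection (B : Cone k) (hB : ∀ A, Cone.phi θ A * B = B * A)
    (P : Type u) [AddCommGroup P] [Module (Cone k) P] : TwistedTensor k θ P →ₗ[Cone k] P :=
  lift θ (fun x p => (x * B) • p) (fun x y p => by rw [add_mul, add_smul])
    (fun a x p => by rw [mul_assoc, mul_smul]) (fun x p q => smul_add _ _ _)
    (fun x a p => by rw [mul_assoc, hB, ← mul_assoc, mul_smul])

/-- The linear map `W ⊗_Γ P → Q` which corresponds to a `φ`-semilinear map. -/
noncomputable def ofSemilinear (f : P →ₛₗ[(Cone.phi (k := k) θ).toRingHom] Q) :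
    TwistedTensor k θ P →ₗ[Cone k] Q :=
  lift θ (fun x p => x • f p) (fun x y p => add_smul _ _ _) (fun a x p => mul_smul _ _ _)
    (fun x p q => by rw [map_add, smul_add])
    (fun x a p => by rw [mul_smul, map_smulₛₗ]; rfl)

variable (P) in
/-- The `φ`-semilinear map `P → W ⊗_Γ P`, `p ↦ 1 ⊗ p`. -/
noncomputable def semilinearUnit :
    P →ₛₗ[(Cone.phi (k := k) θ).toRingHom] TwistedTensor k θ P where
  toFun p := tmul θ 1 p
  map_add' p q := tmul_add _ _ _ _
  map_smul' a p := by
    rw [← mul_phi_tmul, smul_tmul, mul_one, one_mul]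
    rfl

end TwistedTensor

end Tensor

/-! ### The functor W ⊗_Γ -: its right adjoint and its splitting -/

section Twist

variable (k : Type u) [CommRing k] (θ : ℕ ≃ ℕ × ℕ)

/-- Semilinear maps as morphisms to a restriction of scalars. -/
noncomputable def ModuleCat.ofSemilinear {R S : Type u} [Ring R] [Ring S] (f : R →+* S)
    {P : ModuleCat.{u} R} {Q : ModuleCat.{u} S} (g : P →ₛₗ[f] Q) : P ⟶ (ModuleCat.restrictScalars f).obj Q :=
  ModuleCat.ofHom (Y := (ModuleCat.restrictScalars f).obj Q)
    { toFun := g, map_add' := g.map_add, map_smul' := g.map_smulₛₗ }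

/-- The semilinear identity of a module, on its restriction of scalars. -/
noncomputable def ModuleCat.semilinearCounit {R S : Type u} [Ring R] [Ring S] (f : R →+* S)
    (Q : ModuleCat.{u} S) : (ModuleCat.restrictScalars f).obj Q →ₛₗ[f] Q where
  toFun q := q
  map_add' _ _ := rfl
  map_smul' _ _ := rfl

/-- The functor `W ⊗_Γ -` is left adjoint to the restriction of scalars along `φ`. -/
noncomputable def twistedTensorAdjunction :
    bimoduleTensor (Cone k) (TwistedBimodule k θ) ⊣
      ModuleCat.restrictScalars.{u} (Cone.phi (k := k) θ).toRingHom where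
  unit :=
    { app P := ModuleCat.ofSemilinear _ (Q := ModuleCat.of _ (TwistedTensor k θ P))
        (TwistedTensor.semilinearUnit θ P)
      naturality _ _ _ := rfl }
  counit :=
    { app M := ModuleCat.ofHom (TwistedTensor.ofSemilinear θ (ModuleCat.semilinearCounit _ M))
      naturality M N f := ModuleCat.hom_ext (TwistedTensor.hom_ext θ fun x m =>
        (f.hom.map_smul x _).symm) }
  left_triangle_components P := ModuleCat.hom_ext (TwistedTensor.hom_ext θ fun x p => by
    change TwistedTensor.tmul θ (x * 1) p = TwistedTensor.tmul θ x p
    rw [mul_one])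
  right_triangle_components M := by
    ext m
    exact one_smul (Cone k) (show M from m)

/-- The functor `P ↦ W ⊗_Γ P` on right `Γ`-modules is a left adjoint. -/
noncomputable def twistAdjunction : twist k θ ⊣
    (ModuleCat.restrictScalars.{u} (Cone.transposeEquiv k).toRingHom ⋙
      ModuleCat.restrictScalars.{u} (Cone.phi (k := k) θ).toRingHom) ⋙
        ModuleCat.restrictScalars.{u} (Cone.transposeEquiv k).symm.toRingHom :=
  (ModuleCat.restrictScalarsEquivalenceOfRingEquiv (Cone.transposeEquiv k)).toAdjunction.comp
    ((twistedTensorAdjunction k θ).comp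
      (ModuleCat.restrictScalarsEquivalenceOfRingEquiv (Cone.transposeEquiv k)).symm.toAdjunction)

/-- A decomposition of a functor `F` as the sum of the identity functor and `F`. -/
structure FlasqueDecomposition {C : Type w} [Category.{v} C] [Preadditive C] (F : C ⥤ C) where
  inl : 𝟭 C ⟶ F
  inr : F ⟶ F
  fst : F ⟶ 𝟭 C
  snd : F ⟶ F
  inl_fst : inl ≫ fst = 𝟙 _
  inl_snd : inl ≫ snd = 0
  inr_fst : inr ≫ fst = 0
  inr_snd : inr ≫ snd = 𝟙 _
  total : fst ≫ inl + snd ≫ inr = 𝟙 _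

/-- The isomorphism of bimodules `Γ ⊕ W ≃ W`, tensored with a module. -/
noncomputable def twistedTensorDecomposition :
    FlasqueDecomposition (bimoduleTensor (Cone k) (TwistedBimodule k θ)) where
  inl :=
    { app P := ModuleCat.ofHom (TwistedTensor.inclusion θ _ (Cone.mul_layerZero θ) P)
      naturality _ _ _ := rfl }
  inr :=
    { app P := ModuleCat.ofHom (TwistedTensor.mulRight θ _ (Cone.phi_mul_layerSucc θ) P)
      naturality _ _ _ := ModuleCat.hom_ext (TwistedTensor.hom_ext θ fun _ _ => rfl) }
  fst :=
    { app P := ModuleCat.ofHom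
        (TwistedTensor.projection θ _ (Cone.phi_mul_transpose_layerZero θ) P)
      naturality _ _ f := ModuleCat.hom_ext (TwistedTensor.hom_ext θ fun _ p =>
        (f.hom.map_smul _ p).symm) }
  snd :=
    { app P := ModuleCat.ofHom (TwistedTensor.mulRight θ _ (Cone.phi_mul_transpose_layerSucc θ) P)
      naturality _ _ _ := ModuleCat.hom_ext (TwistedTensor.hom_ext θ fun _ _ => rfl) }
  inl_fst := by
    ext P p
    change (Cone.layerZero θ k * (Cone.layerZero θ k).transpose) • p = p
    rw [Cone.layerZero, Cone.ofInjective_mul_transpose, one_smul]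
  inl_snd := by
    ext P p
    change TwistedTensor.tmul θ (Cone.layerZero θ k * (Cone.layerSucc θ k).transpose) p = 0
    rw [Cone.layerZero, Cone.layerSucc,
      Cone.ofInjective_mul_transpose_eq_zero _ _ (Cone.layerZero_ne_layerSucc θ),
      TwistedTensor.zero_tmul]
  inr_fst := by
    ext P : 2
    refine ModuleCat.hom_ext (TwistedTensor.hom_ext θ fun x p => ?_)
    change (x * Cone.layerSucc θ k * (Cone.layerZero θ k).transpose) • p = 0
    rw [mul_assoc, Cone.layerZero, Cone.layerSucc, Cone.ofInjective_mul_transpose_eq_zero _ _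
      fun i j => (Cone.layerZero_ne_layerSucc θ j i).symm, mul_zero, zero_smul]
  inr_snd := by
    ext P : 2
    refine ModuleCat.hom_ext (TwistedTensor.hom_ext θ fun x p => ?_)
    change TwistedTensor.tmul θ (x * Cone.layerSucc θ k * (Cone.layerSucc θ k).transpose) p =
      TwistedTensor.tmul θ x p
    rw [mul_assoc, Cone.layerSucc, Cone.ofInjective_mul_transpose, mul_one]
  total := by
    ext P : 2
    refine ModuleCat.hom_ext (TwistedTensor.hom_ext θ fun x p => ?_)
    change TwistedTensor.tmul θ (Cone.layerZero θ k) ((x * (Cone.layerZero θ k).transpose) • p) +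
      TwistedTensor.tmul θ (x * (Cone.layerSucc θ k).transpose * Cone.layerSucc θ k) p =
        TwistedTensor.tmul θ x p
    -- In the first term the scalar x Sᵀ crosses the tensor sign as φ(x Sᵀ), and S φ(x Sᵀ) = x Sᵀ S.
    -- What remains is Sᵀ S + Tᵀ T = 1.
    rw [← TwistedTensor.mul_phi_tmul, ← TwistedTensor.add_tmul, ← Cone.mul_layerZero,
      mul_assoc, mul_assoc, ← mul_add, Cone.layerZero, Cone.layerSucc,
      Cone.transpose_mul_ofInjective_add _ _ (Cone.layerZero_ne_layerSucc θ)
        (Cone.eq_layerZero_or_layerSucc θ), mul_one]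

/-- Transport of a decomposition along an equivalence of categories. -/
@[simps]
def FlasqueDecomposition.conj {C : Type w₁} [Category.{v₁} C] [Preadditive C]
    {D : Type w₂} [Category.{v₂} D] [Preadditive D] (e : C ≌ D) [e.inverse.Additive]
    {F : D ⥤ D} (h : FlasqueDecomposition F) :
    FlasqueDecomposition (e.functor ⋙ F ⋙ e.inverse) where
  inl := e.unit ≫ Functor.whiskerLeft e.functor (Functor.whiskerRight h.inl e.inverse)
  inr := Functor.whiskerLeft e.functor (Functor.whiskerRight h.inr e.inverse)
  fst := Functor.whiskerLeft e.functor (Functor.whiskerRight h.fst e.inverse) ≫ e.unitInv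
  snd := Functor.whiskerLeft e.functor (Functor.whiskerRight h.snd e.inverse)
  inl_fst := by
    ext X
    have := congr_app h.inl_fst (e.functor.obj X)
    dsimp at this ⊢
    rw [Category.assoc, ← Functor.map_comp_assoc, this]
    simp
  inl_snd := by
    ext X
    have := congr_app h.inl_snd (e.functor.obj X)
    dsimp at this ⊢
    rw [Category.assoc, ← Functor.map_comp, this]
    simp
  inr_fst := by
    ext X
    have := congr_app h.inr_fst (e.functor.obj X)
    dsimp at this ⊢
    rw [← Functor.map_comp_assoc, this]
    simp
  inr_snd := by
    ext X
    have := congr_app h.inr_snd (e.functor.obj X)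
    dsimp at this ⊢
    rw [← Functor.map_comp, this]
    simp
  total := by
    ext X
    have := congr_app h.total (e.functor.obj X)
    dsimp at this ⊢
    have h' : e.unitInv.app X ≫ e.unit.app X = 𝟙 _ := e.unitIso.inv_hom_id_app X
    rw [Category.assoc, reassoc_of% h', ← Functor.map_comp, ← Functor.map_comp, ← Functor.map_add,
      this]
    simp

/-- The decomposition of `W ⊗_Γ -` on right modules. -/
noncomputable def twistDecomposition : FlasqueDecomposition (twist k θ) :=
  (twistedTensorDecomposition k θ).conj
    (ModuleCat.restrictScalarsEquivalenceOfRingEquiv (Cone.transposeEquiv k))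

/-- The right adjoint is a composite of restrictions of scalars, which are exact and preserve
coproducts. -/
theorem IsPerfect.twist {P : CochainComplex (ModuleCat.{u} (Cone k)ᵐᵒᵖ) ℤ} (hP : IsPerfect P) :
    IsPerfect ((twistDG k θ).obj P) :=
  have (R S : Type u) [Ring R] [Ring S] (f : R →+* S) :
      Limits.PreservesFiniteLimits (ModuleCat.restrictScalars.{u} f) :=
    ⟨fun _ _ _ => ⟨fun {_} => inferInstance⟩⟩
  have (R S : Type u) [Ring R] [Ring S] (f : R →+* S) :
      Limits.PreservesFiniteColimits (ModuleCat.restrictScalars.{u} f) :=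
    ⟨fun _ _ _ => ⟨fun {_} => inferInstance⟩⟩
  hP.map (twistAdjunction k θ)

end Twist

/-! ### Cochains on biproducts, and sums in the dg category -/

section BiprodCochains

open Limits CochainComplex.HomComplex

variable {C : Type w} [Category.{v} C] [Preadditive C] [HasBinaryBiproducts C]
  {K K' L L' M : CochainComplex C ℤ}

/-- The cochain on a biproduct with given restrictions to the summands. -/
noncomputable def biprodDescCochain {n : ℤ} (f : Cochain K M n) (g : Cochain L M n) :
    Cochain (K ⊞ L) M n :=
  (Cochain.ofHom biprod.fst).comp f (zero_add n) + (Cochain.ofHom biprod.snd).comp g (zero_add n)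

@[simp] theorem inl_biprodDescCochain {n : ℤ} (f : Cochain K M n) (g : Cochain L M n) :
    (Cochain.ofHom biprod.inl).comp (biprodDescCochain f g) (zero_add n) = f := by
  ext p q hpq
  simp [biprodDescCochain, ← HomologicalComplex.comp_f_assoc]

@[simp] theorem inr_biprodDescCochain {n : ℤ} (f : Cochain K M n) (g : Cochain L M n) :
    (Cochain.ofHom biprod.inr).comp (biprodDescCochain f g) (zero_add n) = g := by
  ext p q hpq
  simp [biprodDescCochain, ← HomologicalComplex.comp_f_assoc]

/-- Cochains need not commute with differentials, so the universal property of the biproduct of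
complexes does not apply to them directly. The identity fst ≫ inl + snd ≫ inr = 𝟙 does, in every
degree. -/
theorem biprod_cochain_total {n : ℤ} (f : Cochain (K ⊞ L) M n) :
    biprodDescCochain ((Cochain.ofHom biprod.inl).comp f (zero_add n))
      ((Cochain.ofHom biprod.inr).comp f (zero_add n)) = f := by
  rw [biprodDescCochain, ← Cochain.comp_assoc_of_first_is_zero_cochain,
    ← Cochain.comp_assoc_of_first_is_zero_cochain, ← Cochain.add_comp, ← Cochain.ofHom_comp,
    ← Cochain.ofHom_comp, ← Cochain.ofHom_add, biprod.total, Cochain.id_comp]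

theorem biprod_cochain_ext {n : ℤ} {f g : Cochain (K ⊞ L) M n}
    (hl : (Cochain.ofHom biprod.inl).comp f (zero_add n) =
      (Cochain.ofHom biprod.inl).comp g (zero_add n))
    (hr : (Cochain.ofHom biprod.inr).comp f (zero_add n) =
      (Cochain.ofHom biprod.inr).comp g (zero_add n)) : f = g := by
  rw [← biprod_cochain_total f, hl, hr, biprod_cochain_total]

/-- The sum of two cochains. -/
noncomputable def biprodMapCochain {n : ℤ} (f : Cochain K K' n) (g : Cochain L L' n) :
    Cochain (K ⊞ L) (K' ⊞ L') n :=
  biprodDescCochain (f.comp (Cochain.ofHom biprod.inl) (add_zero n))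
    (g.comp (Cochain.ofHom biprod.inr) (add_zero n))

@[simp] theorem inl_biprodMapCochain {n : ℤ} (f : Cochain K K' n) (g : Cochain L L' n) :
    (Cochain.ofHom biprod.inl).comp (biprodMapCochain f g) (zero_add n) =
      f.comp (Cochain.ofHom biprod.inl) (add_zero n) := inl_biprodDescCochain _ _

@[simp] theorem inr_biprodMapCochain {n : ℤ} (f : Cochain K K' n) (g : Cochain L L' n) :
    (Cochain.ofHom biprod.inr).comp (biprodMapCochain f g) (zero_add n) =
      g.comp (Cochain.ofHom biprod.inr) (add_zero n) := inr_biprodDescCochain _ _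

theorem inl_biprodMapCochain_comp {n m l : ℤ} (h : n + m = l) (f : Cochain K K' n)
    (g : Cochain L L' n) (e : Cochain (K' ⊞ L') M m) :
    (Cochain.ofHom biprod.inl).comp ((biprodMapCochain f g).comp e h) (zero_add l) =
      f.comp ((Cochain.ofHom biprod.inl).comp e (zero_add m)) h := by
  rw [← Cochain.comp_assoc_of_first_is_zero_cochain, inl_biprodMapCochain,
    Cochain.comp_assoc_of_second_is_zero_cochain]

theorem inr_biprodMapCochain_comp {n m l : ℤ} (h : n + m = l) (f : Cochain K K' n)
    (g : Cochain L L' n) (e : Cochain (K' ⊞ L') M m) :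
    (Cochain.ofHom biprod.inr).comp ((biprodMapCochain f g).comp e h) (zero_add l) =
      g.comp ((Cochain.ofHom biprod.inr).comp e (zero_add m)) h := by
  rw [← Cochain.comp_assoc_of_first_is_zero_cochain, inr_biprodMapCochain,
    Cochain.comp_assoc_of_second_is_zero_cochain]

variable (k : Type u) [CommRing k] [Linear k C]

/-- Cochains on a biproduct are pairs of cochains. -/
noncomputable def biprodCochainEquiv (K L M : CochainComplex C ℤ) (n : ℤ) :
    Cochain (K ⊞ L) M n ≃ₗ[k] Cochain K M n × Cochain L M n where
  toFun f := ((Cochain.ofHom biprod.inl).comp f (zero_add n),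
    (Cochain.ofHom biprod.inr).comp f (zero_add n))
  map_add' _ _ := Prod.ext (Cochain.comp_add _ _ _ (zero_add n))
    (Cochain.comp_add _ _ _ (zero_add n))
  map_smul' _ _ := Prod.ext (Cochain.comp_smul _ _ _ (zero_add n))
    (Cochain.comp_smul _ _ _ (zero_add n))
  invFun f := biprodDescCochain f.1 f.2
  left_inv := biprod_cochain_total
  right_inv f := Prod.ext (inl_biprodDescCochain f.1 f.2) (inr_biprodDescCochain f.1 f.2)

/-- The sum of cochains, as a linear map. -/
noncomputable def biprodMapCochainLinear (K K' L L' : CochainComplex C ℤ) (n : ℤ) :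
    Cochain K K' n × Cochain L L' n →ₗ[k] Cochain (K ⊞ L) (K' ⊞ L') n where
  toFun f := biprodMapCochain f.1 f.2
  map_add' f g := by
    apply biprod_cochain_ext
    · simp only [Cochain.comp_add, inl_biprodMapCochain, Prod.fst_add, Cochain.add_comp]
    · simp only [Cochain.comp_add, inr_biprodMapCochain, Prod.snd_add, Cochain.add_comp]
  map_smul' c f := by
    apply biprod_cochain_ext
    · simp only [Cochain.comp_smul, inl_biprodMapCochain, Prod.smul_fst, Cochain.smul_comp,
        RingHom.id_apply]
    · simp only [Cochain.comp_smul, inr_biprodMapCochain, Prod.smul_snd, Cochain.smul_comp,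
        RingHom.id_apply]

end BiprodCochains

section Sums

open Limits CochainComplex.HomComplex

variable (k : Type u) [CommRing k] (H : Type u) [Ring H] [Algebra k H]

/-- The sum of perfect complexes, as a dg functor. -/
noncomputable def PerfDG.sum : DGFunctor k (PerfDG H × PerfDG H) (PerfDG H) where
  obj X := ⟨X.1.1 ⊞ X.2.1, X.1.2.biprod X.2.2⟩
  map {X Y n} := biprodMapCochainLinear k X.1.1 Y.1.1 X.2.1 Y.2.1 n
  map_d {X Y n m} h f := by
    change biprodMapCochain (δ n m f.1) (δ n m f.2) = δ n m (biprodMapCochain f.1 f.2)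
    apply biprod_cochain_ext
    · rw [← δ_ofHom_comp, inl_biprodMapCochain, inl_biprodMapCochain, δ_comp_ofHom]
    · rw [← δ_ofHom_comp, inr_biprodMapCochain, inr_biprodMapCochain, δ_comp_ofHom]
  map_id X := by
    change biprodMapCochain (Cochain.ofHom (𝟙 _)) (Cochain.ofHom (𝟙 _)) = Cochain.ofHom (𝟙 _)
    apply biprod_cochain_ext <;> simp
  map_comp {X Y Z n m l} h f g := by
    change biprodMapCochain (Cochain.comp f.1 g.1 h) (Cochain.comp f.2 g.2 h) =
      (biprodMapCochain f.1 f.2).comp (biprodMapCochain g.1 g.2) h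
    apply biprod_cochain_ext
    · rw [inl_biprodMapCochain_comp, inl_biprodMapCochain, inl_biprodMapCochain,
        Cochain.comp_assoc_of_third_is_zero_cochain]
    · rw [inr_biprodMapCochain_comp, inr_biprodMapCochain, inr_biprodMapCochain,
        Cochain.comp_assoc_of_third_is_zero_cochain]

/-- The sum is left adjoint to the diagonal. -/
noncomputable def PerfDG.sumAdjunction :
    DGAdjunction (PerfDG.sum k H) (DGFunctor.diagonal k (PerfDG H)) where
  homEquiv X Y n := biprodCochainEquiv k X.1.1 X.2.1 Y.1 n
  homEquiv_d {X Y n m} h f := by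
    refine Prod.ext (x := (_, _)) (y := (_, _)) ?_ ?_
    · exact (δ_ofHom_comp (F := X.1.1) biprod.inl f m).symm
    · exact (δ_ofHom_comp (F := X.2.1) biprod.inr f m).symm
  homEquiv_naturality_left {X X' Y n m l} h f g := by
    refine Prod.ext (x := (_, _)) (y := (_, _)) ?_ ?_
    · exact inl_biprodMapCochain_comp h f.1 f.2 g
    · exact inr_biprodMapCochain_comp h f.1 f.2 g
  homEquiv_naturality_right {X Y Y' n m l} h f g := by
    refine Prod.ext (x := (_, _)) (y := (_, _)) ?_ ?_
    · exact (Cochain.comp_assoc_of_first_is_zero_cochain (F := X.1.1)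
        (Cochain.ofHom biprod.inl) f g h).symm
    · exact (Cochain.comp_assoc_of_first_is_zero_cochain (F := X.2.1)
        (Cochain.ofHom biprod.inr) f g h).symm

end Sums

/-! ### Closed morphisms of degree zero are morphisms of complexes -/

section ZeroCycles

open CochainComplex.HomComplex

variable (k : Type u) [CommRing k] (H : Type u) [Ring H] [Algebra k H]

/-- The functor which regards a morphism of perfect complexes as a closed morphism of degree zero
in the dg category. -/
noncomputable def PerfDG.toZeroCycles : Perf H ⥤ ZeroCycles k (PerfDG H) where
  obj X := ⟨⟨X.obj, X.property⟩⟩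
  map f := ⟨Cochain.ofHom f.hom, δ_ofHom f.hom⟩
  map_id _ := rfl
  map_comp f g := Subtype.ext (Cochain.ofHom_comp f.hom g.hom)

instance : (PerfDG.toZeroCycles k H).Faithful where
  map_injective h := ObjectProperty.hom_ext _ (Cochain.ofHom_injective (congrArg Subtype.val h))

instance : (PerfDG.toZeroCycles k H).Full where
  map_surjective f :=
    ⟨ObjectProperty.homMk (Cocycle.homOf ⟨f.1, (Cocycle.mem_iff 0 1 rfl _).2 f.2⟩),
      Subtype.ext (Cocycle.cochain_ofHom_homOf_eq_coe _)⟩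

instance : (PerfDG.toZeroCycles k H).EssSurj where
  mem_essImage X := ⟨⟨X.as.1, X.as.2⟩, ⟨Iso.refl _⟩⟩

instance : (PerfDG.toZeroCycles k H).IsEquivalence where

end ZeroCycles

/-! ### The isomorphism Id ⊕ τ ≃ τ on complexes -/

section Flasque

open Limits CochainComplex.HomComplex

variable {C : Type w} [Category.{v} C] [Preadditive C] [HasBinaryBiproducts C]
  {F : C ⥤ C} [F.Additive] (h : FlasqueDecomposition F)

/-- A decomposition of `F` as the sum of the identity and `F` induces such a decomposition for
complexes. -/
@[simps]
noncomputable def FlasqueDecomposition.complexIso (K : CochainComplex C ℤ) :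
    K ⊞ (F.mapHomologicalComplex (ComplexShape.up ℤ)).obj K ≅
      (F.mapHomologicalComplex (ComplexShape.up ℤ)).obj K where
  hom := biprod.desc
    { f n := h.inl.app (K.X n), comm' _ _ _ := (h.inl.naturality _).symm }
    { f n := h.inr.app (K.X n), comm' _ _ _ := (h.inr.naturality _).symm }
  inv := biprod.lift
    { f n := h.fst.app (K.X n), comm' _ _ _ := (h.fst.naturality _).symm }
    { f n := h.snd.app (K.X n), comm' _ _ _ := (h.snd.naturality _).symm }
  hom_inv_id := by
    apply biprod.hom_ext' <;> apply biprod.hom_ext <;> ext n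
    · simp
      exact congr_app h.inl_fst (K.X n)
    · simp
      exact congr_app h.inl_snd (K.X n)
    · simp
      exact congr_app h.inr_fst (K.X n)
    · simp
      exact congr_app h.inr_snd (K.X n)
  inv_hom_id := by
    rw [biprod.lift_desc]
    ext n
    exact congr_app h.total (K.X n)

/-- Each component of a cochain is an arbitrary morphism of C, and the isomorphism is built
degreewise from natural transformations of functors on C. Naturality thus holds in all degrees, not
only for morphisms of complexes. -/
theorem FlasqueDecomposition.complexIso_hom_naturality {K L : CochainComplex C ℤ} {n : ℤ}
    (f : Cochain K L n) :
    (biprodMapCochain f (f.map F)).comp (Cochain.ofHom (h.complexIso L).hom) (add_zero n) =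
      (Cochain.ofHom (h.complexIso K).hom).comp (f.map F) (zero_add n) := by
  apply biprod_cochain_ext
  · rw [inl_biprodMapCochain_comp, ← Cochain.comp_assoc_of_first_is_zero_cochain,
      ← Cochain.ofHom_comp, ← Cochain.ofHom_comp, complexIso_hom, complexIso_hom, biprod.inl_desc,
      biprod.inl_desc]
    ext p q hpq
    simp
    exact h.inl.naturality (f.v p q hpq)
  · rw [inr_biprodMapCochain_comp, ← Cochain.comp_assoc_of_first_is_zero_cochain,
      ← Cochain.ofHom_comp, ← Cochain.ofHom_comp, complexIso_hom, complexIso_hom, biprod.inr_desc,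
      biprod.inr_desc]
    ext p q hpq
    simp
    exact h.inr.naturality (f.v p q hpq)

end Flasque

section

open CochainComplex.HomComplex

variable (k : Type u) [CommRing k] (θ : ℕ ≃ ℕ × ℕ)

/-- The restriction to perfect complexes of the dg functor `W ⊗_Γ -`. -/
noncomputable def PerfDG.twist : DGFunctor k (PerfDG (Cone k)) (PerfDG (Cone k)) where
  obj P := ⟨(twistDG k θ).obj P.1, P.2.twist k θ⟩
  map := (twistDG k θ).map
  map_d h f := (twistDG k θ).map_d h f
  map_id P := (twistDG k θ).map_id P.1
  map_comp h f g := (twistDG k θ).map_comp h f g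

/-- The natural isomorphism between `Id ⊕ τ` and `τ`. -/
noncomputable def PerfDG.flasqueIso :
    DGNatIso (((DGFunctor.id k (PerfDG (Cone k))).pair (PerfDG.twist k θ)).comp
      (PerfDG.sum k (Cone k))) (PerfDG.twist k θ) where
  hom P := Cochain.ofHom ((twistDecomposition k θ).complexIso P.1).hom
  inv P := Cochain.ofHom ((twistDecomposition k θ).complexIso P.1).inv
  d_hom _ := δ_ofHom _
  d_inv _ := δ_ofHom _
  hom_inv_id P := (Cochain.ofHom_comp _ _).symm.trans
    (congrArg Cochain.ofHom ((twistDecomposition k θ).complexIso P.1).hom_inv_id)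
  inv_hom_id P := (Cochain.ofHom_comp _ _).symm.trans
    (congrArg Cochain.ofHom ((twistDecomposition k θ).complexIso P.1).inv_hom_id)
  naturality f := (twistDecomposition k θ).complexIso_hom_naturality f

/-- The identity of a dg functor. -/
def DGNatIso.refl {k : Type u} [CommRing k] {A : Type w₁} {B : Type w₂}
    [DGCategory.{v₁} k A] [DGCategory.{v₂} k B] (F : DGFunctor k A B) : DGNatIso F F where
  hom x := DGCategory.id (F.obj x)
  inv x := DGCategory.id (F.obj x)
  d_hom _ := DGCategory.d_id _
  d_inv _ := DGCategory.d_id _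
  hom_inv_id _ := DGCategory.id_comp _
  inv_hom_id _ := DGCategory.id_comp _
  naturality _ := (DGCategory.comp_id _).trans (DGCategory.id_comp _).symm

end

theorem proposition5p2 (k : Type u) [CommRing k] (θ : ℕ ≃ ℕ × ℕ) :
    Nonempty (ZeroCycles k (PerfDG (Cone k)) ≌ Perf (Cone k)) ∧
    ∃ (sum : DGFunctor k (PerfDG (Cone k) × PerfDG (Cone k)) (PerfDG (Cone k)))
      (τ : DGFunctor k (PerfDG (Cone k)) (PerfDG (Cone k))),
      Nonempty (DGAdjunction sum (DGFunctor.diagonal k (PerfDG (Cone k)))) ∧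
      Nonempty (DGNatIso
        (τ.comp (DGFunctor.inclusion k (CochainComplex (ModuleCat.{u} (Cone k)ᵐᵒᵖ) ℤ) IsPerfect))
        ((DGFunctor.inclusion k (CochainComplex (ModuleCat.{u} (Cone k)ᵐᵒᵖ) ℤ) IsPerfect).comp
          (twistDG k θ))) ∧
      Nonempty (DGNatIso (((DGFunctor.id k (PerfDG (Cone k))).pair τ).comp sum) τ) :=
  -- Since τ is the restriction of W ⊗ - itself, the two dg functors to be compared agree
  -- definitionally, and the identity is the required isomorphism.
  ⟨⟨(PerfDG.toZeroCycles k (Cone k)).asEquivalence.symm⟩, PerfDG.sum k (Cone k), PerfDG.twist k θ,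
    ⟨PerfDG.sumAdjunction k (Cone k)⟩, ⟨DGNatIso.refl _⟩, ⟨PerfDG.flasqueIso k θ⟩⟩
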